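/- Let $-\infty\le a<b\le\infty$ and let $\mathcal{HK}$ be the set of real-valued Henstock--Kurzweil integrable functions on $(a,b)$. For $f\in\mathcal{HK}$ let $\|f\|=\sup_I\left|\int_I f\right|$ be the Alexiewicz norm, the supremum being over all intervals $I\subset(a,b)$. Let $g_n$ ($n\ge 1$) and $g$ be real-valued functions on $(a,b)$ such that $g_n\to g$ in Lebesgue measure on $(a,b)$ or $g_n\to g$ almost everywhere on $(a,b)$. Then the following are equivalent: (i) for every $f\in\mathcal{HK}$, all the products $fg_n$ and $fg$ belong to $\mathcal{HK}$ and $\|fg_n\|\to\|fg\|$ as $n\to\infty$; (ii) for every $f\in\mathcal{HK}$, all the products $fg_n$ and $fg$ belong to $\mathcal{HK}$ and $\|fg_n-fg\|\to 0$ as $n\to\infty$. -/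

import Mathlib

open Filter Topology MeasureTheory

namespace HK

/-- The trace on the real line of the open interval with extended real endpoints. -/
def openInterval (a b : EReal) : Set ℝ := {x : ℝ | a < (x : EReal) ∧ (x : EReal) < b}

/-- A gauge on the extended real line: to each point an open set containing it is assigned,
and the open set assigned to a real number contains neither of the points at infinity. -/
structure IsGauge (γ : EReal → Set EReal) : Prop where
  isOpen : ∀ t, IsOpen (γ t)
  mem : ∀ t, t ∈ γ t
  bot_notMem : ∀ t : ℝ, ⊥ ∉ γ (t : EReal)
  top_notMem : ∀ t : ℝ, ⊤ ∉ γ (t : EReal)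

/-- A tagged partition of the closed interval `[a, b]` of the extended real line, with division
points `a = x 0 < x 1 < ⋯ < x N = b` and tags `t i ∈ [x i, x (i + 1)]`.  The values of `x` and `t`
at other indices play no role. -/
structure TaggedPartition (a b : EReal) where
  N : ℕ
  x : ℕ → EReal
  t : ℕ → EReal
  x_zero : x 0 = a
  x_last : x N = b
  x_lt : ∀ i < N, x i < x (i + 1)
  tag_mem : ∀ i < N, t i ∈ Set.Icc (x i) (x (i + 1))

/-- The partition is fine for the gauge: each interval lies in the open set of its tag. -/
def TaggedPartition.IsFine {a b : EReal} (P : TaggedPartition a b) (γ : EReal → Set EReal) :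
    Prop :=
  ∀ i < P.N, Set.Icc (P.x i) (P.x (i + 1)) ⊆ γ (P.t i)

open scoped Classical in
/-- The integrand on `[a, b]`: the function `f` inside `(a, b)`, and `0` at the endpoints
(in particular at `±∞`). -/
noncomputable def integrand (f : ℝ → ℝ) (a b t : EReal) : ℝ :=
  if a < t ∧ t < b then f t.toReal else 0

/-- The Riemann sum.  An interval of infinite length in a partition that is fine for a gauge has
its tag at `±∞`, where the integrand is `0`, so it contributes `0`. -/
noncomputable def TaggedPartition.riemannSum {a b : EReal} (P : TaggedPartition a b)
    (f : ℝ → ℝ) : ℝ :=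
  ∑ i ∈ Finset.range P.N,
    integrand f a b (P.t i) * ((P.x (i + 1)).toReal - (P.x i).toReal)

/-- `A` is the Henstock--Kurzweil integral of `f` over `(a, b)`. -/
def HasIntegral (f : ℝ → ℝ) (a b : EReal) (A : ℝ) : Prop :=
  ∀ ε : ℝ, 0 < ε → ∃ γ : EReal → Set EReal, IsGauge γ ∧
    ∀ P : TaggedPartition a b, P.IsFine γ → |P.riemannSum f - A| < ε

/-- `f` is Henstock--Kurzweil integrable on `(a, b)`. -/
def Integrable (f : ℝ → ℝ) (a b : EReal) : Prop := ∃ A : ℝ, HasIntegral f a b A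

open scoped Classical in
/-- The Henstock--Kurzweil integral of `f` over `(a, b)` (with value `0` if it does not exist). -/
noncomputable def integral (f : ℝ → ℝ) (a b : EReal) : ℝ :=
  if h : ∃ A : ℝ, HasIntegral f a b A then h.choose else 0

/-- The Alexiewicz norm on `(a, b)`: the supremum of `|∫_I f|` over the intervals `I ⊆ (a, b)`,
which are given by their endpoints `c ≤ d`. -/
noncomputable def alexiewiczNorm (f : ℝ → ℝ) (a b : EReal) : ℝ :=
  sSup {r : ℝ | ∃ c d : EReal, a ≤ c ∧ c ≤ d ∧ d ≤ b ∧ r = |integral f c d|}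

/-- Adding one interval at the right end of a fine partition. -/
theorem exists_fine_snoc {γ : EReal → Set EReal} {a c d s : EReal}
    (h : ∃ P : TaggedPartition a c, P.IsFine γ) (hcd : c < d) (hs : s ∈ Set.Icc c d)
    (hsub : Set.Icc c d ⊆ γ s) : ∃ P : TaggedPartition a d, P.IsFine γ := by
  obtain ⟨P, hP⟩ := h
  refine ⟨⟨P.N + 1, fun i => if i ≤ P.N then P.x i else d, fun i => if i < P.N then P.t i else s,
    by simp [P.x_zero], by simp, ?_, ?_⟩, ?_⟩
  · intro i hi
    rcases Nat.lt_succ_iff_lt_or_eq.mp hi with h | h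
    · have h1 : i + 1 ≤ P.N := h
      simpa [h.le, h1] using P.x_lt i h
    · subst h
      simpa [P.x_last] using hcd
  · intro i hi
    rcases Nat.lt_succ_iff_lt_or_eq.mp hi with h | h
    · have h1 : i + 1 ≤ P.N := h
      simpa [h.le, h1, h] using P.tag_mem i h
    · subst h
      simpa [P.x_last] using hs
  · intro i hi
    rcases Nat.lt_succ_iff_lt_or_eq.mp hi with h | h
    · have h1 : i + 1 ≤ P.N := h
      simpa [h.le, h1, h] using hP i h
    · subst h
      simpa [P.x_last] using hsub

/-- Every gauge admits a fine tagged partition of every closed interval. -/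
theorem exists_fine {γ : EReal → Set EReal} (hγ : IsGauge γ) {a b : EReal} (hab : a ≤ b) :
    ∃ P : TaggedPartition a b, P.IsFine γ := by
  set S : Set EReal := {c | a ≤ c ∧ c ≤ b ∧ ∃ P : TaggedPartition a c, P.IsFine γ} with hS
  have haS : a ∈ S :=
    ⟨le_rfl, hab, ⟨0, fun _ => a, fun _ => a, rfl, rfl, by simp, by simp⟩, by
      intro i hi; exact absurd hi (Nat.not_lt_zero i)⟩
  set s := sSup S with hs
  have has : a ≤ s := le_sSup haS
  have hsb : s ≤ b := sSup_le fun c hc => hc.2.1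
  have hnhds : γ s ∈ 𝓝 s := (hγ.isOpen s).mem_nhds (hγ.mem s)
  have hsS : s ∈ S := by
    rcases has.eq_or_lt with h | h
    · rw [← h]; exact haS
    obtain ⟨l, hl, hlsub⟩ := exists_Ioc_subset_of_mem_nhds hnhds ⟨a, h⟩
    obtain ⟨c, hcS, hlc⟩ := lt_sSup_iff.mp hl
    have hcs : c ≤ s := le_sSup hcS
    rcases hcs.eq_or_lt with h2 | h2
    · rw [← h2]; exact hcS
    exact ⟨has, hsb, exists_fine_snoc hcS.2.2 h2 ⟨hcs, le_rfl⟩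
      fun y hy => hlsub ⟨hlc.trans_le hy.1, hy.2⟩⟩
  rcases hsb.eq_or_lt with h | h
  · rw [← h]; exact hsS.2.2
  · exfalso
    obtain ⟨u, hu, husub⟩ := exists_Ico_subset_of_mem_nhds hnhds ⟨b, h⟩
    obtain ⟨d, hd1, hd2⟩ := exists_between (lt_min hu h)
    have : d ∈ S := ⟨has.trans hd1.le, (hd2.trans_le (min_le_right _ _)).le,
      exists_fine_snoc hsS.2.2 hd1 ⟨le_rfl, hd1.le⟩
        fun y hy => husub ⟨hy.1, hy.2.trans_lt (hd2.trans_le (min_le_left _ _))⟩⟩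
    exact absurd (le_sSup this) (not_le.mpr hd1)

/-- The integral is unique. -/
theorem HasIntegral.unique {f : ℝ → ℝ} {a b : EReal} (hab : a ≤ b) {A B : ℝ}
    (hA : HasIntegral f a b A) (hB : HasIntegral f a b B) : A = B := by
  by_contra hne
  have hε : 0 < |A - B| / 2 := half_pos (abs_pos.mpr (sub_ne_zero.mpr hne))
  obtain ⟨γ, hγ, h1⟩ := hA _ hε
  obtain ⟨η, hη, h2⟩ := hB _ hε
  have hg : IsGauge fun t => γ t ∩ η t :=
    ⟨fun t => (hγ.isOpen t).inter (hη.isOpen t), fun t => ⟨hγ.mem t, hη.mem t⟩,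
      fun t h => hγ.bot_notMem t h.1, fun t h => hγ.top_notMem t h.1⟩
  obtain ⟨P, hP⟩ := exists_fine hg hab
  have e1 := h1 P fun i hi y hy => (hP i hi hy).1
  have e2 := h2 P fun i hi y hy => (hP i hi hy).2
  have : |A - B| ≤ |P.riemannSum f - A| + |P.riemannSum f - B| := by
    rw [abs_sub_comm (P.riemannSum f) A]
    exact abs_sub_le _ _ _
  linarith

/-- The integral is the number that the definition singles out. -/
theorem HasIntegral.integral_eq {f : ℝ → ℝ} {a b : EReal} (hab : a ≤ b) {A : ℝ}
    (hA : HasIntegral f a b A) : integral f a b = A := by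
  have h : ∃ A : ℝ, HasIntegral f a b A := ⟨A, hA⟩
  rw [integral, dif_pos h]
  exact h.choose_spec.unique hab hA

end HK

/-! (ii) ⇒ (i) is the reverse triangle inequality. For (i) ⇒ (ii) put `h n = g n - g₀`. All that is
needed from the norm convergence in (i) is that, for each `f`, the norms of `f * g n` stay bounded;
so multiplication by `h n` is a pointwise bounded sequence of operators.

The Alexiewicz norm is not complete, so Banach–Steinhaus is replaced by a gliding hump. If uniform
boundedness fails on every right neighbourhood of a point `p`, there are functions of norm at most
one on non-overlapping intervals shrinking to `p` whose products with suitable `h n` have norm above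
`4 ^ k`. Summed with weights `2 ^ (-k)` they give, by Hake's theorem, an integrable function that
contradicts pointwise boundedness. Reflection treats left neighbourhoods, and Cousin's lemma patches
the local bounds into one constant `C` (`PointwiseBounded.uniformlyBounded`).

Testing this bound on the constant 1 over `[x, y]` shows that the primitives of `h n` on compact
intervals are `C`-Lipschitz. They are therefore absolutely continuous with derivative `h n` almost
everywhere, and if `h n → 0` almost everywhere, dominated convergence sends their variations to zero
(`eventually_oscLe_of_lipschitz`). Hence products with step functions tend to zero in norm. Step
functions are dense, since their primitives approximate continuous functions uniformly, and the
bound `C` carries the conclusion over to every `f` (`PointwiseBounded.annihilates`). Convergence in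
measure reduces to this case by passing to subsequences.

Integrals are handled through Perron–Ward primitives (`IsPrim`): the gauge becomes a neighbourhood
filter and the error an increment of a small monotone function, which suits gluing, Hake's theorem
and almost everywhere differentiation. -/

namespace HK

/-! ### Fine Riemann sums, gauges and Cousin's lemma -/

/-- `s` is the Riemann sum of `φ` over a `γ`-fine tagged partition of `[a, v]`. -/
inductive FineSum (γ : EReal → Set EReal) (φ : EReal → ℝ) (a : EReal) : EReal → ℝ → Prop
  | nil : FineSum γ φ a a 0
  | snoc {u v t : EReal} {s : ℝ} : FineSum γ φ a u s → u < v → u ≤ t → t ≤ v →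
      Set.Icc u v ⊆ γ t → FineSum γ φ a v (s + φ t * (v.toReal - u.toReal))

theorem FineSum.trans {γ : EReal → Set EReal} {φ : EReal → ℝ} {a u v : EReal} {r s : ℝ}
    (h1 : FineSum γ φ a u r) (h2 : FineSum γ φ u v s) : FineSum γ φ a v (r + s) := by
  induction h2 with
  | nil => simpa using h1
  | snoc _ h3 h4 h5 h6 ih => rw [← add_assoc]; exact ih.snoc h3 h4 h5 h6

theorem FineSum.mono {γ η : EReal → Set EReal} {φ : EReal → ℝ} {a v : EReal} {s : ℝ}
    (h : FineSum γ φ a v s) (hη : ∀ t, γ t ⊆ η t) : FineSum η φ a v s := by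
  induction h with
  | nil => exact .nil
  | snoc _ h3 h4 h5 h6 ih => exact ih.snoc h3 h4 h5 (h6.trans (hη _))

theorem TaggedPartition.le_x {a b : EReal} (P : TaggedPartition a b) :
    ∀ i ≤ P.N, a ≤ P.x i
  | 0, _ => P.x_zero.ge
  | i + 1, h => (P.le_x i (by omega)).trans (P.x_lt i h).le

theorem TaggedPartition.x_mono {a b : EReal} (P : TaggedPartition a b) {i : ℕ} :
    ∀ j, i ≤ j → j ≤ P.N → P.x i ≤ P.x j := by
  intro j hij
  induction j, hij using Nat.le_induction with
  | base => intro _; exact le_rfl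
  | succ j _ ih => intro h; exact (ih (by omega)).trans (P.x_lt j h).le

theorem TaggedPartition.x_le {a b : EReal} (P : TaggedPartition a b) (i : ℕ) (h : i ≤ P.N) :
    P.x i ≤ b := (P.x_mono P.N h le_rfl).trans P.x_last.le

theorem TaggedPartition.fineSum {a b : EReal} (P : TaggedPartition a b)
    {γ : EReal → Set EReal} (hP : P.IsFine γ) (φ : EReal → ℝ) :
    FineSum γ φ a b (∑ i ∈ Finset.range P.N,
      φ (P.t i) * ((P.x (i + 1)).toReal - (P.x i).toReal)) := by
  have : ∀ j ≤ P.N, FineSum γ φ a (P.x j) (∑ i ∈ Finset.range j,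
      φ (P.t i) * ((P.x (i + 1)).toReal - (P.x i).toReal)) := by
    intro j
    induction j with
    | zero => intro _; simpa [P.x_zero] using FineSum.nil
    | succ j ih =>
      intro h
      rw [Finset.sum_range_succ]
      exact (ih (by omega)).snoc (P.x_lt j h) (P.tag_mem j h).1 (P.tag_mem j h).2 (hP j h)
  simpa [P.x_last] using this P.N le_rfl

theorem FineSum.exists_partition {γ : EReal → Set EReal} {φ : EReal → ℝ} {a v : EReal} {s : ℝ}
    (h : FineSum γ φ a v s) : ∃ P : TaggedPartition a v, P.IsFine γ ∧
      ∑ i ∈ Finset.range P.N, φ (P.t i) * ((P.x (i + 1)).toReal - (P.x i).toReal) = s := by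
  induction h with
  | nil => exact ⟨⟨0, fun _ => a, fun _ => a, rfl, rfl, by simp, by simp⟩, by
      intro i hi; exact absurd hi (Nat.not_lt_zero i), by simp⟩
  | @snoc c d s' r _ hcd hs1 hs2 hsub ih =>
    obtain ⟨P, hP, hs⟩ := ih
    refine ⟨⟨P.N + 1, fun i => if i ≤ P.N then P.x i else d, fun i => if i < P.N then P.t i else s',
      by simp [P.x_zero], by simp, ?_, ?_⟩, ?_, ?_⟩
    · intro i hi
      rcases Nat.lt_succ_iff_lt_or_eq.mp hi with h | h
      · have h1 : i + 1 ≤ P.N := h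
        simpa [h.le, h1] using P.x_lt i h
      · subst h
        simpa [P.x_last] using hcd
    · intro i hi
      rcases Nat.lt_succ_iff_lt_or_eq.mp hi with h | h
      · have h1 : i + 1 ≤ P.N := h
        simpa [h.le, h1, h] using P.tag_mem i h
      · subst h
        simpa [P.x_last] using ⟨hs1, hs2⟩
    · intro i hi
      rcases Nat.lt_succ_iff_lt_or_eq.mp hi with h | h
      · have h1 : i + 1 ≤ P.N := h
        simpa [h.le, h1, h] using hP i h
      · subst h
        simpa [P.x_last] using hsub
    · simp only
      rw [Finset.sum_range_succ, ← hs]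
      congr 1
      · refine Finset.sum_congr rfl fun i hi => ?_
        have h := Finset.mem_range.1 hi
        have h1 : i + 1 ≤ P.N := h
        simp [h, h.le, h1]
      · simp [P.x_last]

theorem exists_fineSum {γ : EReal → Set EReal} (hγ : IsGauge γ) (φ : EReal → ℝ) {a b : EReal}
    (hab : a ≤ b) : ∃ s, FineSum γ φ a b s := by
  obtain ⟨P, hP⟩ := exists_fine hγ hab
  exact ⟨_, P.fineSum hP φ⟩

theorem IsGauge.inter {γ η : EReal → Set EReal} (hγ : IsGauge γ) (hη : IsGauge η) :
    IsGauge fun t => γ t ∩ η t :=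
  ⟨fun t => (hγ.isOpen t).inter (hη.isOpen t), fun t => ⟨hγ.mem t, hη.mem t⟩,
    fun t h => hγ.bot_notMem t h.1, fun t h => hγ.top_notMem t h.1⟩

/-- Below any choice of neighbourhoods there is a gauge. -/
theorem exists_isGauge_subset {U : EReal → Set EReal} (hU : ∀ t, U t ∈ 𝓝 t) :
    ∃ γ, IsGauge γ ∧ ∀ t, γ t ⊆ U t := by
  -- Deleting the points at infinity other than `t` itself keeps the set an open neighbourhood of
  -- `t` and makes the gauge condition hold at real points.
  refine ⟨fun t => interior (U t) ∩ (({⊥, ⊤} : Set EReal) \ {t})ᶜ, ⟨fun t => ?_, fun t => ?_,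
    fun t h => ?_, fun t h => ?_⟩, fun t => Set.inter_subset_left.trans interior_subset⟩
  · exact isOpen_interior.inter
      (((Set.finite_singleton _).insert _).subset Set.sdiff_subset).isClosed.isOpen_compl
  · exact ⟨mem_interior_iff_mem_nhds.2 (hU t), by simp⟩
  · exact h.2 (by simp)
  · exact h.2 (by simp)

theorem exists_isGauge_of_eventually {a b : EReal} {R : EReal → EReal × EReal → Prop}
    (h : ∀ t, a ≤ t → t ≤ b → ∀ᶠ p in 𝓝 (t, t), R t p) :
    ∃ γ, IsGauge γ ∧ ∀ t, a ≤ t → t ≤ b → ∀ u ∈ γ t, ∀ v ∈ γ t, R t (u, v) := by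
  have : ∀ t, ∃ U ∈ 𝓝 t, a ≤ t → t ≤ b → ∀ u ∈ U, ∀ v ∈ U, R t (u, v) := by
    intro t
    by_cases ht : a ≤ t ∧ t ≤ b
    · have := h t ht.1 ht.2
      rw [nhds_prod_eq, Filter.Eventually, mem_prod_self_iff] at this
      obtain ⟨U, hU, h⟩ := this
      exact ⟨U, hU, fun _ _ u hu v hv => h (Set.mk_mem_prod hu hv)⟩
    · exact ⟨Set.univ, univ_mem, fun h1 h2 => absurd ⟨h1, h2⟩ ht⟩
  choose U hU hQ using this
  obtain ⟨γ, hγ, hγU⟩ := exists_isGauge_subset hU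
  exact ⟨γ, hγ, fun t h1 h2 u hu v hv => hQ t h1 h2 u (hγU t hu) v (hγU t hv)⟩

/-- Cousin's lemma as an induction principle: a property of intervals which is additive and holds
for small intervals around each point holds for every interval. -/
theorem cousin_induction {Q : EReal → EReal → Prop} {a b : EReal} (hab : a ≤ b)
    (hrefl : Q a a)
    (htrans : ∀ u v w, a ≤ u → u < v → v < w → w ≤ b → Q u v → Q v w → Q u w)
    (hloc : ∀ t, a ≤ t → t ≤ b →
      ∀ᶠ p : EReal × EReal in 𝓝 (t, t), a ≤ p.1 → p.1 ≤ t → t ≤ p.2 → p.2 ≤ b → p.1 < p.2 →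
        Q p.1 p.2) : Q a b := by
  obtain ⟨γ, hγ, hQ⟩ := exists_isGauge_of_eventually hloc
  obtain ⟨P, hP⟩ := exists_fine hγ hab
  have key : ∀ i ≤ P.N, Q a (P.x i) := by
    intro i
    induction i with
    | zero => intro _; simpa [P.x_zero] using hrefl
    | succ i ih =>
      intro h
      have hlt := P.x_lt i h
      have h1 := P.le_x i (by omega)
      have h2 := P.x_le (i + 1) h
      have ht := P.tag_mem i h
      have hq : Q (P.x i) (P.x (i + 1)) := hQ (P.t i) (h1.trans ht.1) (ht.2.trans h2) _
        (hP i h ⟨le_rfl, hlt.le⟩) _ (hP i h ⟨hlt.le, le_rfl⟩) h1 ht.1 ht.2 h2 hlt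
      rcases h1.eq_or_lt with h3 | h3
      · rwa [← h3] at hq
      · exact htrans _ _ _ le_rfl h3 hlt h2 (ih (by omega)) hq
  simpa [P.x_last] using key P.N le_rfl

/-! ### Perron–Ward primitives and their equivalence with the gauge integral -/

/-- `F` is a Henstock--Kurzweil primitive of `φ` on `[a, b]`, in the sense of Perron and Ward: up to
the increments of an arbitrarily small monotone function, the increments of `F` over short
intervals around `t` are `φ t` times the length. -/
def IsPrim (φ : EReal → ℝ) (F : EReal → ℝ) (a b : EReal) : Prop :=
  ∀ ε : ℝ, 0 < ε → ∃ W : EReal → ℝ, Monotone W ∧ (∀ x, 0 ≤ W x ∧ W x ≤ ε) ∧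
    ∀ t, a ≤ t → t ≤ b → ∀ᶠ p : EReal × EReal in 𝓝 (t, t), a ≤ p.1 → p.1 ≤ t → t ≤ p.2 →
      p.2 ≤ b → |φ t * (p.2.toReal - p.1.toReal) - (F p.2 - F p.1)| ≤ W p.2 - W p.1

theorem IsPrim.hasIntegral {f : ℝ → ℝ} {F : EReal → ℝ} {a b : EReal}
    (h : IsPrim (integrand f a b) F a b) : HasIntegral f a b (F b - F a) := by
  intro ε hε
  obtain ⟨W, -, hW, hloc⟩ := h (ε / 2) (half_pos hε)
  set φ := integrand f a b
  obtain ⟨γ, hγ, hQ⟩ := exists_isGauge_of_eventually hloc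
  refine ⟨γ, hγ, fun P hP => ?_⟩
  have e : P.riemannSum f - (F b - F a) = ∑ i ∈ Finset.range P.N,
      (φ (P.t i) * ((P.x (i + 1)).toReal - (P.x i).toReal) - (F (P.x (i + 1)) - F (P.x i))) := by
    rw [Finset.sum_sub_distrib, Finset.sum_range_sub (fun i => F (P.x i)), P.x_last, P.x_zero]
    rfl
  rw [e]
  calc _ ≤ ∑ i ∈ Finset.range P.N, (W (P.x (i + 1)) - W (P.x i)) := by
        refine (Finset.abs_sum_le_sum_abs _ _).trans (Finset.sum_le_sum fun i hi => ?_)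
        have h := Finset.mem_range.1 hi
        have hlt := P.x_lt i h
        have h1 := P.le_x i (by omega)
        have h2 := P.x_le (i + 1) h
        have ht := P.tag_mem i h
        exact hQ (P.t i) (h1.trans ht.1) (ht.2.trans h2) _
          (hP i h ⟨le_rfl, hlt.le⟩) _ (hP i h ⟨hlt.le, le_rfl⟩) h1 ht.1 ht.2 h2
    _ = W b - W a := by rw [Finset.sum_range_sub (fun i => W (P.x i)), P.x_last, P.x_zero]
    _ < ε := by linarith [(hW a).1, (hW b).2]

/-- Henstock's lemma in Perron–Ward form. Completing two fine sums over `[a, x]` by the same fine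
partition of `[x, b]` shows that they differ by at most `2 * ε`. The fine sums thus determine `F x`
in the limit, and their spread is the monotone function `W`. -/
theorem HasIntegral.exists_isPrim {f : ℝ → ℝ} {a b : EReal} (hab : a ≤ b) {A : ℝ}
    (h : HasIntegral f a b A) : ∃ F, IsPrim (integrand f a b) F a b ∧ F b - F a = A := by
  have h' : ∀ ε : ℝ, ∃ γ : EReal → Set EReal, 0 < ε → IsGauge γ ∧
      ∀ s, FineSum γ (integrand f a b) a b s → |s - A| < ε := by
    intro ε
    by_cases hε : 0 < ε
    · obtain ⟨γ, hγ, h⟩ := h ε hε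
      refine ⟨γ, fun _ => ⟨hγ, fun s hs => ?_⟩⟩
      obtain ⟨P, hP, rfl⟩ := hs.exists_partition
      exact h P hP
    · exact ⟨fun _ => Set.univ, fun h => absurd h hε⟩
  choose Γ hΓ using h'
  set φ := integrand f a b
  have hgauge : ∀ ε, 0 < ε → IsGauge (Γ ε) := fun ε hε => (hΓ ε hε).1
  have hb : ∀ ε, 0 < ε → ∀ s, FineSum (Γ ε) φ a b s → |s - A| < ε := fun ε hε => (hΓ ε hε).2
  have hdiff : ∀ ε, 0 < ε → ∀ x ≤ b, ∀ s s', FineSum (Γ ε) φ a x s → FineSum (Γ ε) φ a x s' →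
      s - s' ≤ 2 * ε := by
    intro ε hε x hx s s' hs hs'
    obtain ⟨r, hr⟩ := exists_fineSum (hgauge ε hε) φ hx
    have h1 := abs_lt.1 (hb ε hε _ (hs.trans hr))
    have h2 := abs_lt.1 (hb ε hε _ (hs'.trans hr))
    linarith [h1.2, h2.1]
  have hF : ∀ x, ∃ y, a ≤ x → x ≤ b → ∀ ε, 0 < ε → ∀ s, FineSum (Γ ε) φ a x s →
      |s - y| ≤ 2 * ε := by
    intro x
    set S := {z | ∃ ε, 0 < ε ∧ ∃ s, FineSum (Γ ε) φ a x s ∧ z = s - 2 * ε}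
    -- Every number `s - 2 * ε` lies below every number `s' + 2 * η`, by comparison with a sum fine
    -- for both gauges; the supremum separates the two families.
    refine ⟨sSup S, fun hax hxb => ?_⟩
    have hub : ∀ ε, 0 < ε → ∀ s, FineSum (Γ ε) φ a x s → s + 2 * ε ∈ upperBounds S := by
      rintro ε hε s hs _ ⟨η, hη, s', hs', rfl⟩
      obtain ⟨r, hr⟩ := exists_fineSum ((hgauge ε hε).inter (hgauge η hη)) φ hax
      have h1 := hdiff ε hε x hxb _ _ (hr.mono fun t => Set.inter_subset_left) hs
      have h2 := hdiff η hη x hxb _ _ hs' (hr.mono fun t => Set.inter_subset_right)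
      linarith
    intro ε hε s hs
    have hmem : s - 2 * ε ∈ S := ⟨ε, hε, s, hs, rfl⟩
    have h1 := le_csSup ⟨_, hub ε hε s hs⟩ hmem
    have h2 := csSup_le ⟨_, hmem⟩ (hub ε hε s hs)
    rw [abs_le]
    constructor <;> linarith
  choose F hF using hF
  refine ⟨F, ?_, ?_⟩
  · intro ε hε
    have hδ : 0 < ε / 2 := half_pos hε
    set γ := Γ (ε / 2)
    set S : EReal → Set ℝ := fun x => {s | FineSum γ φ a x s}
    have hne : ∀ x, a ≤ x → (S x).Nonempty := fun x hx => exists_fineSum (hgauge _ hδ) φ hx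
    have hbdd : ∀ x, a ≤ x → x ≤ b → BddAbove (S x) := by
      intro x hax hxb
      obtain ⟨s, hs⟩ := hne x hax
      exact ⟨s + 2 * (ε / 2), fun r hr => by linarith [hdiff _ hδ x hxb r s hr hs]⟩
    have hbdd' : ∀ x, a ≤ x → x ≤ b → BddBelow (S x) := by
      intro x hax hxb
      obtain ⟨s, hs⟩ := hne x hax
      exact ⟨s - 2 * (ε / 2), fun r hr => by linarith [hdiff _ hδ x hxb s r hs hr]⟩
    have hup : ∀ u v, a ≤ u → u ≤ v → v ≤ b → ∀ s, FineSum γ φ u v s →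
        s ≤ sSup (S v) - sSup (S u) := by
      intro u v hau huv hvb s hs
      rw [le_sub_iff_add_le, ← le_sub_iff_add_le']
      exact csSup_le (hne u hau) fun r hr => by
        linarith [le_csSup (hbdd v (hau.trans huv) hvb) (hr.trans hs : FineSum γ φ a v (r + s))]
    have hlow : ∀ u v, a ≤ u → u ≤ v → v ≤ b → ∀ s, FineSum γ φ u v s →
        sInf (S v) - sInf (S u) ≤ s := by
      intro u v hau huv hvb s hs
      have : sInf (S v) - s ≤ sInf (S u) := le_csInf (hne u hau) fun r hr => by
        linarith [csInf_le (hbdd' v (hau.trans huv) hvb) (hr.trans hs : FineSum γ φ a v (r + s))]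
      linarith
    -- A partition fine for two gauges yields a `γ`-fine sum that is as close to the increment of
    -- `F` as desired.
    have hFs : ∀ u v, a ≤ u → u ≤ v → v ≤ b → ∀ η, 0 < η →
        ∃ s, FineSum γ φ u v s ∧ |s - (F v - F u)| ≤ 4 * η := by
      intro u v hau huv hvb η hη
      have hg := (hgauge _ hδ).inter (hgauge η hη)
      obtain ⟨r, hr⟩ := exists_fineSum hg φ hau
      obtain ⟨s, hs⟩ := exists_fineSum hg φ huv
      refine ⟨s, hs.mono fun t => Set.inter_subset_left, ?_⟩
      have h1 := abs_le.1 (hF u hau (huv.trans hvb) η hη r (hr.mono fun t => Set.inter_subset_right))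
      have h2 := abs_le.1 (hF v (hau.trans huv) hvb η hη _
        ((hr.trans hs).mono fun t => Set.inter_subset_right))
      rw [abs_le]
      constructor <;> linarith [h1.1, h1.2, h2.1, h2.2]
    have hFup : ∀ u v, a ≤ u → u ≤ v → v ≤ b → F v - F u ≤ sSup (S v) - sSup (S u) := by
      intro u v hau huv hvb
      refine le_of_forall_pos_le_add fun η hη => ?_
      obtain ⟨s, hs, hs'⟩ := hFs u v hau huv hvb (η / 4) (by linarith)
      linarith [(abs_le.1 hs').1, hup u v hau huv hvb s hs]
    have hFlow : ∀ u v, a ≤ u → u ≤ v → v ≤ b → sInf (S v) - sInf (S u) ≤ F v - F u := by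
      intro u v hau huv hvb
      refine le_of_forall_pos_le_add fun η hη => ?_
      obtain ⟨s, hs, hs'⟩ := hFs u v hau huv hvb (η / 4) (by linarith)
      linarith [(abs_le.1 hs').2, hlow u v hau huv hvb s hs]
    set cl : EReal → EReal := fun x => max a (min x b)
    have cl1 : ∀ x, a ≤ cl x := fun x => le_max_left _ _
    have cl2 : ∀ x, cl x ≤ b := fun x => max_le hab (min_le_right _ _)
    have cl3 : ∀ x, a ≤ x → x ≤ b → cl x = x := fun x h1 h2 => by
      simp only [cl, min_eq_left h2, max_eq_right h1]
    have cl4 : Monotone cl := fun x y hxy => max_le_max le_rfl (min_le_min hxy le_rfl)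
    -- The spread of the fine sums, extended by clamping to `[a, b]`. The increment of `F` over `[u,
    -- v]` and the one-term sum there both lie between the increments of the infimum and of the
    -- supremum, so they differ by at most the increment of the spread.
    refine ⟨fun x => sSup (S (cl x)) - sInf (S (cl x)), ?_, ?_, ?_⟩
    · intro u v huv
      have h1 := hFup _ _ (cl1 u) (cl4 huv) (cl2 v)
      have h2 := hFlow _ _ (cl1 u) (cl4 huv) (cl2 v)
      simp only
      linarith
    · intro x
      obtain ⟨s, hs⟩ := hne _ (cl1 x)
      refine ⟨sub_nonneg.2 ((csInf_le (hbdd' _ (cl1 x) (cl2 x)) hs).trans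
        (le_csSup (hbdd _ (cl1 x) (cl2 x)) hs)), ?_⟩
      rw [sub_le_iff_le_add]
      refine csSup_le ⟨s, hs⟩ fun r hr => ?_
      rw [← sub_le_iff_le_add']
      exact le_csInf ⟨s, hs⟩ fun r' hr' => by linarith [hdiff _ hδ _ (cl2 x) r r' hr hr']
    · intro t hat htb
      obtain ⟨c, d, -, hcd, hsub⟩ := exists_Icc_mem_subset_of_mem_nhds
        (((hgauge _ hδ).isOpen t).mem_nhds ((hgauge _ hδ).mem t))
      rw [nhds_prod_eq]
      filter_upwards [prod_mem_prod hcd hcd] with p hp hau hut htv hvb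
      obtain ⟨hp1, hp2⟩ := hp
      have huv := hut.trans htv
      have huv' : FineSum γ φ p.1 p.2 (φ t * (p.2.toReal - p.1.toReal)) := by
        rcases huv.eq_or_lt with h | h
        · rw [h]; simpa using FineSum.nil
        · rw [← zero_add (φ t * _)]
          exact FineSum.nil.snoc h hut htv
            fun y hy => hsub ⟨hp1.1.trans hy.1, hy.2.trans hp2.2⟩
      simp only [cl3 _ hau (huv.trans hvb), cl3 _ (hau.trans huv) hvb]
      have h1 := hFup _ _ hau huv hvb
      have h2 := hFlow _ _ hau huv hvb
      have h3 := hup _ _ hau huv hvb _ huv'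
      have h4 := hlow _ _ hau huv hvb _ huv'
      rw [abs_le]
      constructor <;> linarith
  · have ha : F a = 0 := by
      by_contra hne
      have h1 := hF a le_rfl hab (|F a| / 4) (by positivity) 0 .nil
      rw [zero_sub, abs_neg] at h1
      linarith [abs_pos.2 hne]
    rw [ha, sub_zero]
    by_contra hne
    have h0 : 0 < |F b - A| := abs_pos.2 (sub_ne_zero.2 hne)
    have h4 : 0 < |F b - A| / 4 := by positivity
    obtain ⟨s, hs⟩ := exists_fineSum (hgauge _ h4) φ hab
    have h1 := hF b hab le_rfl _ h4 s hs
    have h2 := hb _ h4 s hs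
    have h3 := abs_sub_le (F b) s A
    rw [abs_sub_comm (F b) s] at h3
    linarith

/-! ### Calculus of primitives on the extended line -/

open scoped Classical in
/-- A function on the real line as a function on the extended real line, with value `0` at the
points at infinity. -/
noncomputable def lift (f : ℝ → ℝ) (t : EReal) : ℝ := if t = ⊥ ∨ t = ⊤ then 0 else f t.toReal

@[simp] theorem lift_bot (f : ℝ → ℝ) : lift f ⊥ = 0 := by simp [lift]

@[simp] theorem lift_top (f : ℝ → ℝ) : lift f ⊤ = 0 := by simp [lift]

@[simp] theorem lift_coe (f : ℝ → ℝ) (x : ℝ) : lift f x = f x := by simp [lift]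

theorem integrand_bot (f : ℝ → ℝ) (a b : EReal) : integrand f a b ⊥ = 0 := by simp [integrand]

theorem integrand_top (f : ℝ → ℝ) (a b : EReal) : integrand f a b ⊤ = 0 := by simp [integrand]

theorem integrand_eq_lift (f : ℝ → ℝ) {a b t : EReal} (h1 : a < t) (h2 : t < b) :
    integrand f a b t = lift f t := by
  have h3 : t ≠ ⊥ := (bot_le.trans_lt h1).ne'
  have h4 : t ≠ ⊤ := (h2.trans_le le_top).ne
  simp [integrand, lift, h1, h2, h3, h4]

/-- `EReal.toReal` is continuous at real points only; at infinity the vanishing of `φ` is what makes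
the term small. -/
theorem eventually_abs_mul_length_lt {φ : EReal → ℝ} (h1 : φ ⊥ = 0) (h2 : φ ⊤ = 0) (t : EReal)
    {ε : ℝ} (hε : 0 < ε) :
    ∀ᶠ p : EReal × EReal in 𝓝 (t, t), |φ t * (p.2.toReal - p.1.toReal)| < ε := by
  induction t with
  | bot => simp [h1, hε]
  | top => simp [h2, hε]
  | coe x =>
    have hx : ContinuousAt EReal.toReal (x : EReal) :=
      EReal.tendsto_toReal (EReal.coe_ne_top x) (EReal.coe_ne_bot x)
    have : ContinuousAt (fun p : EReal × EReal => |φ x * (p.2.toReal - p.1.toReal)|)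
        ((x : EReal), (x : EReal)) :=
      (continuousAt_const.mul ((ContinuousAt.comp' (f := Prod.snd) hx continuousAt_snd).sub
        (ContinuousAt.comp' (f := Prod.fst) hx continuousAt_fst))).abs
    exact this.eventually_lt_const (by simpa using hε)

theorem IsPrim.mono {φ F : EReal → ℝ} {a b c d : EReal} (h : IsPrim φ F a b) (hac : a ≤ c)
    (hdb : d ≤ b) : IsPrim φ F c d := by
  intro ε hε
  obtain ⟨W, hW, hW', hloc⟩ := h ε hε
  refine ⟨W, hW, hW', fun t h1 h2 => ?_⟩
  filter_upwards [hloc t (hac.trans h1) (h2.trans hdb)] with p hp h3 h4 h5 h6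
  exact hp (hac.trans h3) h4 h5 (h6.trans hdb)

theorem IsPrim.congr_Icc {φ ψ F G : EReal → ℝ} {a b : EReal} (h : IsPrim φ F a b)
    (hφ : ∀ t, a ≤ t → t ≤ b → φ t = ψ t) (hF : ∀ t, a ≤ t → t ≤ b → F t = G t) :
    IsPrim ψ G a b := by
  intro ε hε
  obtain ⟨W, hW, hW', hloc⟩ := h ε hε
  refine ⟨W, hW, hW', fun t h1 h2 => ?_⟩
  filter_upwards [hloc t h1 h2] with p hp h3 h4 h5 h6
  rw [← hφ t h1 h2, ← hF _ h3 (h4.trans h2), ← hF _ (h1.trans h5) h6]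
  exact hp h3 h4 h5 h6

theorem isPrim_zero (c : ℝ) (a b : EReal) : IsPrim (fun _ => 0) (fun _ => c) a b := by
  intro ε hε
  exact ⟨fun _ => 0, monotone_const, fun _ => ⟨le_rfl, hε.le⟩, fun t _ _ => by simp⟩

theorem IsPrim.add {φ ψ F G : EReal → ℝ} {a b : EReal} (h1 : IsPrim φ F a b)
    (h2 : IsPrim ψ G a b) : IsPrim (fun t => φ t + ψ t) (fun x => F x + G x) a b := by
  intro ε hε
  obtain ⟨W, hW, hW', hloc⟩ := h1 (ε / 2) (half_pos hε)
  obtain ⟨V, hV, hV', hloc'⟩ := h2 (ε / 2) (half_pos hε)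
  refine ⟨fun x => W x + V x, hW.add hV, fun x => ⟨by linarith [(hW' x).1, (hV' x).1], by
    linarith [(hW' x).2, (hV' x).2]⟩, fun t h1 h2 => ?_⟩
  filter_upwards [hloc t h1 h2, hloc' t h1 h2] with p hp hp' h3 h4 h5 h6
  have e1 := abs_le.1 (hp h3 h4 h5 h6)
  have e2 := abs_le.1 (hp' h3 h4 h5 h6)
  rw [abs_le]
  constructor <;> linarith [e1.1, e1.2, e2.1, e2.2]

theorem IsPrim.const_mul {φ F : EReal → ℝ} {a b : EReal} (h : IsPrim φ F a b) (k : ℝ) :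
    IsPrim (fun t => k * φ t) (fun x => k * F x) a b := by
  intro ε hε
  have hk : 0 < |k| + 1 := by positivity
  obtain ⟨W, hW, hW', hloc⟩ := h (ε / (|k| + 1)) (by positivity)
  refine ⟨fun x => |k| * W x, hW.const_mul (abs_nonneg k), fun x =>
    ⟨mul_nonneg (abs_nonneg k) (hW' x).1, ?_⟩, fun t h1 h2 => ?_⟩
  · have := (le_div_iff₀ hk).1 (hW' x).2
    linarith [(hW' x).1]
  · filter_upwards [hloc t h1 h2] with p hp h3 h4 h5 h6
    have := mul_le_mul_of_nonneg_left (hp h3 h4 h5 h6) (abs_nonneg k)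
    rw [← abs_mul] at this
    calc _ = |k * (φ t * (p.2.toReal - p.1.toReal) - (F p.2 - F p.1))| := by ring_nf
      _ ≤ |k| * (W p.2 - W p.1) := this
      _ = _ := by ring

theorem IsPrim.sub {φ ψ F G : EReal → ℝ} {a b : EReal} (h1 : IsPrim φ F a b)
    (h2 : IsPrim ψ G a b) : IsPrim (fun t => φ t - ψ t) (fun x => F x - G x) a b :=
  (h1.add (h2.const_mul (-1))).congr_Icc (fun t _ _ => by ring) (fun t _ _ => by ring)

theorem IsPrim.glue {φ F : EReal → ℝ} {a b c : EReal} (h1 : IsPrim φ F a c)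
    (h2 : IsPrim φ F c b) : IsPrim φ F a b := by
  intro ε hε
  obtain ⟨W, hW, hW', hloc⟩ := h1 (ε / 2) (half_pos hε)
  obtain ⟨V, hV, hV', hloc'⟩ := h2 (ε / 2) (half_pos hε)
  refine ⟨fun x => W x + V x, hW.add hV, fun x => ⟨by linarith [(hW' x).1, (hV' x).1], by
    linarith [(hW' x).2, (hV' x).2]⟩, fun t hat htb => ?_⟩
  rcases lt_trichotomy t c with htc | rfl | htc
  · filter_upwards [hloc t hat htc.le, (continuous_snd.tendsto (t, t)).eventually_lt_const htc]
      with p hp hpc h3 h4 h5 h6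
    have := hV (h4.trans h5)
    linarith [hp h3 h4 h5 hpc.le]
  -- An interval tagged at the common endpoint is split there, and each half is controlled by its
  -- own monotone function.
  · have e1 : Tendsto (fun p : EReal × EReal => (p.1, t)) (𝓝 (t, t)) (𝓝 (t, t)) :=
      (continuous_fst.prodMk continuous_const).tendsto (t, t)
    have e2 : Tendsto (fun p : EReal × EReal => (t, p.2)) (𝓝 (t, t)) (𝓝 (t, t)) :=
      (continuous_const.prodMk continuous_snd).tendsto (t, t)
    filter_upwards [e1.eventually (hloc t hat le_rfl), e2.eventually (hloc' t le_rfl htb)]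
      with p hp hp' h3 h4 h5 h6
    have k1 := abs_le.1 (hp h3 h4 le_rfl le_rfl)
    have k2 := abs_le.1 (hp' le_rfl le_rfl h5 h6)
    have := hW h5
    have := hV h4
    rw [abs_le]
    constructor <;> linarith [k1.1, k1.2, k2.1, k2.2]
  · filter_upwards [hloc' t htc.le htb, (continuous_fst.tendsto (t, t)).eventually_const_lt htc]
      with p hp hpc h3 h4 h5 h6
    have := hW (h4.trans h5)
    linarith [hp hpc.le h4 h5 h6]

/-- Near `p` the error grows by at most `K` times the length, which is the increment of `K` times a
ramp on `[p - δ, p + δ]`; the total rise `2 * δ * K` is as small as needed. -/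
theorem IsPrim.update {φ F : EReal → ℝ} {a b : EReal} (h : IsPrim φ F a b)
    (p : ℝ) (c : ℝ) : IsPrim (Function.update φ p c) F a b := by
  intro ε hε
  obtain ⟨W, hW, hW', hloc⟩ := h (ε / 2) (half_pos hε)
  set K := |c - φ p|
  have hK : 0 ≤ K := abs_nonneg _
  set δ := ε / (4 * (K + 1))
  have hδ : 0 < δ := by positivity
  have hKδ : K * (2 * δ) ≤ ε / 2 := by
    have : (K + 1) * (2 * δ) = ε / 2 := by simp only [δ]; field_simp; ring
    nlinarith
  set l : EReal := ((p - δ : ℝ) : EReal)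
  set r : EReal := ((p + δ : ℝ) : EReal)
  have hlr : l ≤ r := EReal.coe_le_coe_iff.2 (by linarith)
  have hcl : ∀ x : EReal, l ≤ max l (min x r) ∧ max l (min x r) ≤ r := fun x =>
    ⟨le_max_left _ _, max_le hlr (min_le_right _ _)⟩
  have hcl' : ∀ x y : EReal, l ≤ x → x ≤ y → y ≤ r → x.toReal ≤ y.toReal := fun x y h1 h2 h3 =>
    EReal.toReal_le_toReal h2 ((EReal.bot_lt_coe _).trans_le h1).ne'
      (h3.trans_lt (EReal.coe_lt_top _)).ne
  refine ⟨fun x => W x + K * ((max l (min x r)).toReal - (p - δ)), ?_, fun x => ?_,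
    fun t hat htb => ?_⟩
  · refine hW.add (fun x y hxy => mul_le_mul_of_nonneg_left ?_ hK)
    exact sub_le_sub_right (hcl' _ _ (hcl x).1 (max_le_max le_rfl (min_le_min hxy le_rfl))
      (hcl y).2) _
  · have h1 : p - δ ≤ (max l (min x r)).toReal := by
      exact hcl' l _ le_rfl (hcl x).1 (hcl x).2
    have h2 : (max l (min x r)).toReal ≤ p + δ := by
      exact hcl' _ r (hcl x).1 (hcl x).2 le_rfl
    have h3 : K * ((max l (min x r)).toReal - (p - δ)) ≤ K * (2 * δ) :=
      mul_le_mul_of_nonneg_left (by linarith) hK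
    have h4 : 0 ≤ K * ((max l (min x r)).toReal - (p - δ)) := mul_nonneg hK (by linarith)
    constructor <;> linarith [(hW' x).1, (hW' x).2]
  · have hmono : ∀ x y : EReal, x ≤ y → K * ((max l (min x r)).toReal - (p - δ)) ≤
        K * ((max l (min y r)).toReal - (p - δ)) := fun x y hxy =>
      mul_le_mul_of_nonneg_left (sub_le_sub_right (hcl' _ _ (hcl x).1
        (max_le_max le_rfl (min_le_min hxy le_rfl)) (hcl y).2) _) hK
    by_cases htp : t = p
    · subst htp
      have hl : l < (p : EReal) := EReal.coe_lt_coe_iff.2 (by linarith)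
      have hr : (p : EReal) < r := EReal.coe_lt_coe_iff.2 (by linarith)
      filter_upwards [hloc _ hat htb,
        (continuous_fst.tendsto ((p : EReal), (p : EReal))).eventually_const_lt hl,
        (continuous_snd.tendsto ((p : EReal), (p : EReal))).eventually_lt_const hr]
        with q hq hq1 hq2 h3 h4 h5 h6
      have e1 : max l (min q.1 r) = q.1 := by
        rw [min_eq_left (h4.trans hr.le), max_eq_right hq1.le]
      have e2 : max l (min q.2 r) = q.2 := by
        rw [min_eq_left hq2.le, max_eq_right (hl.le.trans h5)]
      have e3 := hcl' _ _ hq1.le (h4.trans h5) hq2.le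
      rw [e1, e2, Function.update_self]
      have e4 : |(c - φ p) * (q.2.toReal - q.1.toReal)| = K * (q.2.toReal - q.1.toReal) := by
        rw [abs_mul, abs_of_nonneg (sub_nonneg.2 e3)]
      have e5 := abs_le.1 e4.le
      have e6 := abs_le.1 (hq h3 h4 h5 h6)
      rw [abs_le]
      constructor <;> linarith [e5.1, e5.2, e6.1, e6.2]
    · filter_upwards [hloc _ hat htb] with q hq h3 h4 h5 h6
      rw [Function.update_of_ne htp]
      linarith [hq h3 h4 h5 h6, hmono _ _ (h4.trans h5)]

theorem IsPrim.exists_update {φ F : EReal → ℝ} {a b : EReal} (h : IsPrim φ F a b) (p : EReal)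
    (c : ℝ) (hc : p = ⊥ ∨ p = ⊤ → φ p = c) : IsPrim (Function.update φ p c) F a b := by
  induction p with
  | bot => rw [← hc (.inl rfl), Function.update_eq_self]; exact h
  | top => rw [← hc (.inr rfl), Function.update_eq_self]; exact h
  | coe x => exact h.update x c

theorem IsPrim.congr_Ioo {φ ψ F G : EReal → ℝ} {a b : EReal} (h : IsPrim φ F a b)
    (hbot : φ ⊥ = ψ ⊥) (htop : φ ⊤ = ψ ⊤)
    (hφ : ∀ t, a < t → t < b → φ t = ψ t) (hF : ∀ t, a ≤ t → t ≤ b → F t = G t) :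
    IsPrim ψ G a b := by
  have h1 := h.exists_update a (ψ a) (by rintro (h | h) <;> simp [h, hbot, htop])
  have h2 := h1.exists_update b (ψ b) (by
    by_cases hab : b = a
    · simp [hab]
    · rintro (h | h) <;> rw [Function.update_of_ne hab] <;> simp [h, hbot, htop])
  refine h2.congr_Icc (fun t hat htb => ?_) hF
  by_cases htb' : t = b
  · simp [htb']
  by_cases hta' : t = a
  · rw [Function.update_of_ne htb', hta', Function.update_self]
  rw [Function.update_of_ne htb', Function.update_of_ne hta',
    hφ t (lt_of_le_of_ne hat (Ne.symm hta')) (lt_of_le_of_ne htb htb')]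

theorem IsPrim.lift_congr {f g : ℝ → ℝ} {F G : EReal → ℝ} {a b : EReal}
    (h : IsPrim (lift f) F a b) (hf : ∀ x : ℝ, a < x → x < b → f x = g x)
    (hF : ∀ t, a ≤ t → t ≤ b → F t = G t) : IsPrim (lift g) G a b := by
  refine h.congr_Ioo (by simp) (by simp) (fun t h1 h2 => ?_) hF
  induction t with
  | bot => simp
  | top => simp
  | coe x => simpa using hf x h1 h2

/-- `lift f` does not depend on the interval, so restricting and gluing need no change of integrand;
the two differ on `[a, b]` at most at its endpoints. -/
theorem isPrim_integrand_iff {f : ℝ → ℝ} {F : EReal → ℝ} {a b : EReal} :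
    IsPrim (integrand f a b) F a b ↔ IsPrim (lift f) F a b :=
  ⟨fun h => h.congr_Ioo (by simp [integrand_bot]) (by simp [integrand_top])
      (fun _ => integrand_eq_lift f) fun _ _ _ => rfl,
    fun h => h.congr_Ioo (by simp [integrand_bot]) (by simp [integrand_top])
      (fun _ h1 h2 => (integrand_eq_lift f h1 h2).symm) fun _ _ _ => rfl⟩

theorem IsPrim.integral_eq {f : ℝ → ℝ} {F : EReal → ℝ} {a b c d : EReal}
    (h : IsPrim (lift f) F a b) (hac : a ≤ c) (hcd : c ≤ d) (hdb : d ≤ b) :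
    integral f c d = F d - F c :=
  (isPrim_integrand_iff.2 (h.mono hac hdb)).hasIntegral.integral_eq hcd

theorem integrable_iff_exists_isPrim {f : ℝ → ℝ} {a b : EReal} (hab : a ≤ b) :
    Integrable f a b ↔ ∃ F, IsPrim (lift f) F a b := by
  constructor
  · rintro ⟨A, hA⟩
    obtain ⟨F, hF, -⟩ := hA.exists_isPrim hab
    exact ⟨F, isPrim_integrand_iff.1 hF⟩
  · rintro ⟨F, hF⟩
    exact ⟨_, (isPrim_integrand_iff.2 hF).hasIntegral⟩

theorem IsPrim.unique {f : ℝ → ℝ} {F G : EReal → ℝ} {a b c d : EReal}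
    (hF : IsPrim (lift f) F a b) (hG : IsPrim (lift f) G a b) (hc : a ≤ c) (hc' : c ≤ b)
    (hd : a ≤ d) (hd' : d ≤ b) : F d - F c = G d - G c := by
  rcases le_total c d with h | h
  · rw [← hF.integral_eq hc h hd', ← hG.integral_eq hc h hd']
  · have := (hF.integral_eq hd h hc').symm.trans (hG.integral_eq hd h hc')
    linarith

theorem IsPrim.continuousOn {φ F : EReal → ℝ} {a b : EReal} (h : IsPrim φ F a b)
    (h1 : φ ⊥ = 0) (h2 : φ ⊤ = 0) : ContinuousOn F (Set.Icc a b) := by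
  intro t ht
  rw [ContinuousWithinAt, Metric.tendsto_nhds]
  intro ε hε
  obtain ⟨W, hW, hW', hloc⟩ := h (ε / 2) (half_pos hε)
  have e : Tendsto (fun x => (min x t, max x t)) (𝓝[Set.Icc a b] t) (𝓝 (t, t)) := by
    have : Continuous fun x : EReal => (min x t, max x t) := by fun_prop
    simpa using (this.tendsto t).mono_left nhdsWithin_le_nhds
  filter_upwards [e.eventually (hloc t ht.1 ht.2),
    e.eventually (eventually_abs_mul_length_lt h1 h2 t (half_pos hε)), self_mem_nhdsWithin]
    with x hx hx' hxm
  have k1 := abs_le.1 (hx (le_min hxm.1 ht.1) (min_le_right _ _) (le_max_right _ _)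
    (max_le hxm.2 ht.2))
  have k2 := abs_lt.1 hx'
  have k3 : |F (max x t) - F (min x t)| < ε := by
    rw [abs_lt]
    constructor <;> linarith [k1.1, k1.2, k2.1, k2.2, (hW' (max x t)).1, (hW' (max x t)).2,
      (hW' (min x t)).1, (hW' (min x t)).2]
  rw [Real.dist_eq]
  rcases le_total x t with h | h
  · rwa [max_eq_right h, min_eq_left h, abs_sub_comm] at k3
  · rwa [max_eq_left h, min_eq_right h] at k3

theorem IsPrim.lift_continuousOn {f : ℝ → ℝ} {F : EReal → ℝ} {a b : EReal}
    (h : IsPrim (lift f) F a b) : ContinuousOn F (Set.Icc a b) :=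
  h.continuousOn (by simp) (by simp)

/-- Hake's theorem at the left endpoint. -/
theorem isPrim_of_forall_lt {φ F : EReal → ℝ} {a b : EReal} (hab : a < b) (hbot : φ ⊥ = 0)
    (htop : φ ⊤ = 0) (h : ∀ c, a < c → c < b → IsPrim φ F c b)
    (hF : ContinuousWithinAt F (Set.Icc a b) a) : IsPrim φ F a b := by
  intro ε hε
  -- The functions `W k` for `[q k, b]` are bounded by a geometric series of sum `ε / 2`. The other
  -- `ε / 2` is a jump just after `a`, which absorbs the intervals tagged at `a`.
  obtain ⟨q, -, hq, hqa⟩ := exists_seq_strictAnti_tendsto' hab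
  choose W hW hW' hloc using fun k : ℕ => h (q k) (hq k).1 (hq k).2 (ε / 2 / 2 / 2 ^ k)
    (by positivity)
  have hsum : ∀ x, Summable fun k => W k x := fun x =>
    Summable.of_nonneg_of_le (fun k => (hW' k x).1) (fun k => (hW' k x).2)
      (summable_geometric_two' _)
  have hmono : ∀ x y, x ≤ y → ∀ k, W k y - W k x ≤ ∑' k, W k y - ∑' k, W k x := by
    intro x y hxy k
    rw [← (hsum y).tsum_sub (hsum x)]
    exact ((hsum y).sub (hsum x)).le_tsum k fun j _ => sub_nonneg.2 (hW j hxy)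
  classical
  have hJ : Monotone fun x : EReal => if a < x then ε / 2 else 0 := by
    intro x y hxy
    by_cases hx : a < x
    · simp [hx, hx.trans_le hxy]
    · simp only [hx, if_false]
      split_ifs <;> linarith
  refine ⟨fun x => ∑' k, W k x + if a < x then ε / 2 else 0, ?_, fun x => ?_,
    fun t hat htb => ?_⟩
  · refine Monotone.add (fun x y hxy => ?_) hJ
    exact (hsum x).tsum_le_tsum (fun k => hW k hxy) (hsum y)
  · have h1 : 0 ≤ ∑' k, W k x := tsum_nonneg fun k => (hW' k x).1
    have h2 : ∑' k, W k x ≤ ε / 2 := (tsum_geometric_two' (ε / 2)) ▸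
      (hsum x).tsum_le_tsum (fun k => (hW' k x).2) (summable_geometric_two' _)
    simp only
    split_ifs <;> constructor <;> linarith
  · rcases hat.eq_or_lt with rfl | hat
    · have e2 : ∀ᶠ p : EReal × EReal in 𝓝 (a, a), p.2 ∈ Set.Icc a b → |F p.2 - F a| < ε / 4 := by
        have := (Metric.tendsto_nhds.1 hF) (ε / 4) (by linarith)
        rw [eventually_nhdsWithin_iff] at this
        exact (continuous_snd.tendsto (a, a)).eventually this
      filter_upwards [e2, eventually_abs_mul_length_lt hbot htop a (by linarith : 0 < ε / 4)]
        with p hp hp' h3 h4 h5 h6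
      have hpa : p.1 = a := le_antisymm h4 h3
      rw [hpa] at hp' ⊢
      rcases h5.eq_or_lt with h7 | h7
      · simp [← h7]
      · have k1 := abs_lt.1 (hp ⟨h5, h6⟩)
        have k2 := abs_lt.1 hp'
        have k3 := hmono _ _ h5 0
        have k4 := hW 0 h5
        simp only [h7, if_true, lt_irrefl, if_false]
        rw [abs_le]
        constructor <;> linarith [k1.1, k1.2, k2.1, k2.2]
    · obtain ⟨k, hk⟩ := (hqa.eventually_lt_const hat).exists
      filter_upwards [hloc k t hk.le htb, (continuous_fst.tendsto (t, t)).eventually_const_lt hk]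
        with p hp hpk h3 h4 h5 h6
      refine (hp hpk.le h4 h5 h6).trans ?_
      have := hJ (h4.trans h5)
      simp only at this ⊢
      linarith [hmono _ _ (h4.trans h5) k]

theorem IsPrim.reflect {φ F : EReal → ℝ} {a b : EReal} (h : IsPrim φ F a b) :
    IsPrim (fun t => φ (-t)) (fun x => - F (-x)) (-b) (-a) := by
  intro ε hε
  obtain ⟨W, hW, hW', hloc⟩ := h ε hε
  -- Reflection reverses monotonicity; subtracting from `ε` restores it within the same bounds.
  refine ⟨fun x => ε - W (-x), fun x y hxy => sub_le_sub_left (hW (EReal.neg_le_neg_iff.2 hxy)) _,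
    fun x => ⟨by linarith [(hW' (-x)).2], by linarith [(hW' (-x)).1]⟩, fun t h1 h2 => ?_⟩
  have e : Tendsto (fun p : EReal × EReal => (-p.2, -p.1)) (𝓝 (t, t)) (𝓝 (-t, -t)) :=
    Continuous.tendsto (by fun_prop) (t, t)
  filter_upwards [e.eventually (hloc (-t) (EReal.le_neg_of_le_neg h2) (EReal.neg_le_of_neg_le h1))]
    with p hp h3 h4 h5 h6
  have := hp (EReal.le_neg_of_le_neg h6) (EReal.neg_le_neg_iff.2 h5) (EReal.neg_le_neg_iff.2 h4)
    (EReal.neg_le_of_neg_le h3)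
  rw [EReal.toReal_neg_eq, EReal.toReal_neg_eq] at this
  calc _ = |φ (-t) * (-p.1.toReal - -p.2.toReal) - (F (-p.1) - F (-p.2))| := by ring_nf
    _ ≤ W (-p.1) - W (-p.2) := this
    _ = _ := by ring

theorem IsPrim.lift_reflect {f : ℝ → ℝ} {F : EReal → ℝ} {a b : EReal}
    (h : IsPrim (lift f) F a b) :
    IsPrim (lift fun x => f (-x)) (fun x => - F (-x)) (-b) (-a) := by
  refine h.reflect.congr_Icc (fun t _ _ => ?_) fun _ _ _ => rfl
  induction t with
  | bot => simp
  | top => simp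
  | coe x => rw [← EReal.coe_neg, lift_coe, lift_coe]

theorem IsPrim.lift_add {f g : ℝ → ℝ} {F G : EReal → ℝ} {a b : EReal}
    (hf : IsPrim (lift f) F a b) (hg : IsPrim (lift g) G a b) :
    IsPrim (lift fun x => f x + g x) (fun x => F x + G x) a b := by
  refine (hf.add hg).congr_Icc (fun t _ _ => ?_) fun _ _ _ => rfl
  induction t <;> simp

theorem IsPrim.lift_sub {f g : ℝ → ℝ} {F G : EReal → ℝ} {a b : EReal}
    (hf : IsPrim (lift f) F a b) (hg : IsPrim (lift g) G a b) :
    IsPrim (lift fun x => f x - g x) (fun x => F x - G x) a b := by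
  refine (hf.sub hg).congr_Icc (fun t _ _ => ?_) fun _ _ _ => rfl
  induction t <;> simp

theorem IsPrim.lift_const_mul {f : ℝ → ℝ} {F : EReal → ℝ} {a b : EReal}
    (hf : IsPrim (lift f) F a b) (k : ℝ) :
    IsPrim (lift fun x => k * f x) (fun x => k * F x) a b := by
  refine (hf.const_mul k).congr_Icc (fun t _ _ => ?_) fun _ _ _ => rfl
  induction t <;> simp

theorem isPrim_lift_zero {f : ℝ → ℝ} {F : EReal → ℝ} {a b : EReal} (c : ℝ)
    (hf : ∀ x : ℝ, a < x → x < b → f x = 0) (hF : ∀ t, a ≤ t → t ≤ b → F t = c) :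
    IsPrim (lift f) F a b := by
  have : IsPrim (lift fun _ => 0) (fun _ => c) a b :=
    (isPrim_zero c a b).congr_Icc (fun t _ _ => by induction t <;> simp) fun _ _ _ => rfl
  exact this.lift_congr (fun x h1 h2 => (hf x h1 h2).symm) fun t h1 h2 => (hF t h1 h2).symm

theorem isPrim_lift_one (c d : ℝ) : IsPrim (lift fun _ => 1) EReal.toReal c d := by
  intro ε hε
  refine ⟨fun _ => 0, monotone_const, fun _ => ⟨le_rfl, hε.le⟩, fun t h1 h2 => ?_⟩
  induction t with
  | bot => simp at h1
  | top => simp at h2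
  | coe x => simp

/-- Extending a function by zero extends its primitive by constants. -/
theorem IsPrim.extend {f g : ℝ → ℝ} {F : EReal → ℝ} {a b c d : EReal}
    (h : IsPrim (lift f) F c d) (hcd : c ≤ d)
    (hg : ∀ x : ℝ, c < x → x < d → g x = f x) (hl : ∀ x : ℝ, x < c → g x = 0)
    (hr : ∀ x : ℝ, d < x → g x = 0) :
    IsPrim (lift g) (fun x => F (max c (min x d))) a b := by
  have h1 : IsPrim (lift g) (fun x => F (max c (min x d))) a c :=
    isPrim_lift_zero (F c) (fun x _ hx => hl x hx) fun t _ ht => by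
      rw [min_eq_left (ht.trans hcd), max_eq_left ht]
  have h2 : IsPrim (lift g) (fun x => F (max c (min x d))) d b :=
    isPrim_lift_zero (F d) (fun x hx _ => hr x hx) fun t ht _ => by
      rw [min_eq_right ht, max_eq_right hcd]
  have h3 : IsPrim (lift g) (fun x => F (max c (min x d))) c d :=
    h.lift_congr (fun x hx hx' => (hg x hx hx').symm) fun t h1 h2 => by
      rw [min_eq_left h2, max_eq_right h1]
  exact (h1.glue h3).glue h2

/-! ### Oscillation and bounds for multipliers -/

/-- The oscillation of `F` on `[a, b]` is at most `C`. -/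
def OscLe (F : EReal → ℝ) (a b : EReal) (C : ℝ) : Prop :=
  ∀ x y, a ≤ x → x ≤ b → a ≤ y → y ≤ b → |F y - F x| ≤ C

theorem OscLe.nonneg {F : EReal → ℝ} {a b : EReal} {C : ℝ} (h : OscLe F a b C) (hab : a ≤ b) :
    0 ≤ C := (abs_nonneg _).trans (h a b le_rfl hab hab le_rfl)

theorem OscLe.mono {F : EReal → ℝ} {a b c d : EReal} {C : ℝ} (h : OscLe F a b C) (hac : a ≤ c)
    (hdb : d ≤ b) : OscLe F c d C := fun x y h1 h2 h3 h4 =>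
  h x y (hac.trans h1) (h2.trans hdb) (hac.trans h3) (h4.trans hdb)

theorem OscLe.reflect {F : EReal → ℝ} {a b : EReal} {C : ℝ} (h : OscLe F a b C) :
    OscLe (fun x => - F (-x)) (-b) (-a) C := by
  intro x y h1 h2 h3 h4
  have := h (-y) (-x) (EReal.le_neg_of_le_neg h4) (EReal.neg_le_of_neg_le h3)
    (EReal.le_neg_of_le_neg h2) (EReal.neg_le_of_neg_le h1)
  simpa [sub_eq_add_neg, add_comm] using this

theorem OscLe.glue {F : EReal → ℝ} {u v w : EReal} {C D : ℝ} (h1 : OscLe F u v C)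
    (h2 : OscLe F v w D) (huv : u ≤ v) (hvw : v ≤ w) : OscLe F u w (C + D) := by
  have hC := h1.nonneg huv
  have hD := h2.nonneg hvw
  intro x y hx hx' hy hy'
  rcases le_total x v with hxv | hxv <;> rcases le_total y v with hyv | hyv
  · linarith [h1 x y hx hxv hy hyv]
  · have := abs_sub_le (F y) (F v) (F x)
    linarith [h1 x v hx hxv huv le_rfl, h2 v y le_rfl hvw hyv hy']
  · have := abs_sub_le (F y) (F v) (F x)
    linarith [h1 v y huv le_rfl hy hyv, h2 x v hxv hx' le_rfl hvw]
  · linarith [h2 x y hxv hx' hyv hy']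

theorem OscLe.const_mul {F : EReal → ℝ} {a b : EReal} {C k : ℝ} (h : OscLe F a b C) (hk : 0 ≤ k) :
    OscLe (fun x => k * F x) a b (k * C) := by
  intro x y h1 h2 h3 h4
  have := mul_le_mul_of_nonneg_left (h x y h1 h2 h3 h4) hk
  rwa [← abs_of_nonneg hk, ← abs_mul, mul_sub, abs_of_nonneg hk] at this

theorem OscLe.clamp {F : EReal → ℝ} {a b c d : EReal} {C : ℝ} (h : OscLe F c d C) (hcd : c ≤ d) :
    OscLe (fun x => F (max c (min x d))) a b C := fun _ _ _ _ _ _ =>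
  h _ _ (le_max_left _ _) (max_le hcd (min_le_right _ _)) (le_max_left _ _)
    (max_le hcd (min_le_right _ _))

/-- Multiplication by each `h n` preserves integrability on `(a, b)`, and the products with a given
function are bounded in the Alexiewicz norm. -/
def PointwiseBounded (h : ℕ → ℝ → ℝ) (a b : EReal) : Prop :=
  ∀ f F, IsPrim (lift f) F a b →
    ∃ B, ∀ n, ∃ H, IsPrim (lift fun x => f x * h n x) H a b ∧ OscLe H a b B

/-- The multiplications by the `h n` are bounded by `C` in the Alexiewicz norm on `(a, b)`. -/
def MulBound (h : ℕ → ℝ → ℝ) (C : ℝ) (a b : EReal) : Prop :=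
  ∀ n f F H, IsPrim (lift f) F a b → IsPrim (lift fun x => f x * h n x) H a b →
    OscLe F a b 1 → OscLe H a b C

/-- The multiplications by the `h n` are uniformly bounded in the Alexiewicz norm on `(a, b)`. -/
def UniformlyBounded (h : ℕ → ℝ → ℝ) (a b : EReal) : Prop := ∃ C, 0 ≤ C ∧ MulBound h C a b

/-- Extension by zero turns an integrable function on `(c, d)` into one on `(a, b)`. -/
theorem PointwiseBounded.mono {h : ℕ → ℝ → ℝ} {a b c d : EReal} (hb : PointwiseBounded h a b)
    (hac : a ≤ c) (hcd : c ≤ d) (hdb : d ≤ b) : PointwiseBounded h c d := by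
  classical
  intro f F hF
  set g : ℝ → ℝ := fun x => if c < x ∧ (x : EReal) < d then f x else 0
  obtain ⟨B, hB⟩ := hb g _ (hF.extend (g := g) hcd (fun x h1 h2 => by simp [g, h1, h2])
    (fun x hx => by simp [g, hx.not_gt]) (fun x hx => by simp [g, hx.not_gt]))
  refine ⟨B, fun n => ?_⟩
  obtain ⟨H, hH, hH'⟩ := hB n
  exact ⟨H, (hH.mono hac hdb).lift_congr (fun x h1 h2 => by simp [g, h1, h2]) fun _ _ _ => rfl,
    hH'.mono hac hdb⟩

theorem MulBound.mono {h : ℕ → ℝ → ℝ} {C : ℝ} {a b c d : EReal} (hb : MulBound h C a b)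
    (hac : a ≤ c) (hcd : c ≤ d) (hdb : d ≤ b) : MulBound h C c d := by
  classical
  intro n f F H hF hH hosc x y hx hx' hy hy'
  set g : ℝ → ℝ := fun x => if c < x ∧ (x : EReal) < d then f x else 0
  have h1 := hF.extend (a := a) (b := b) (g := g) hcd (fun x h1 h2 => by simp [g, h1, h2])
    (fun x hx => by simp [g, hx.not_gt]) (fun x hx => by simp [g, hx.not_gt])
  have h2 := hH.extend (a := a) (b := b) (g := fun x => g x * h n x) hcd
    (fun x h1 h2 => by simp [g, h1, h2])
    (fun x hx => by simp [g, hx.not_gt]) (fun x hx => by simp [g, hx.not_gt])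
  have := hb n g _ _ h1 h2 (hosc.clamp hcd) x y (hac.trans hx) (hx'.trans hdb) (hac.trans hy)
    (hy'.trans hdb)
  simpa only [min_eq_left hx', max_eq_right hx, min_eq_left hy', max_eq_right hy] using this

theorem UniformlyBounded.mono {h : ℕ → ℝ → ℝ} {a b c d : EReal} (hb : UniformlyBounded h a b)
    (hac : a ≤ c) (hcd : c ≤ d) (hdb : d ≤ b) : UniformlyBounded h c d := by
  obtain ⟨C, hC, hb⟩ := hb
  exact ⟨C, hC, hb.mono hac hcd hdb⟩

theorem PointwiseBounded.reflect {h : ℕ → ℝ → ℝ} {a b : EReal} (hb : PointwiseBounded h a b) :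
    PointwiseBounded (fun n x => h n (-x)) (-b) (-a) := by
  intro f F hF
  have h1 := hF.lift_reflect
  rw [neg_neg, neg_neg] at h1
  obtain ⟨B, hB⟩ := hb _ _ h1
  refine ⟨B, fun n => ?_⟩
  obtain ⟨H, hH, hH'⟩ := hB n
  exact ⟨_, by simpa using hH.lift_reflect, hH'.reflect⟩

theorem UniformlyBounded.reflect {h : ℕ → ℝ → ℝ} {a b : EReal} (hb : UniformlyBounded h a b) :
    UniformlyBounded (fun n x => h n (-x)) (-b) (-a) := by
  obtain ⟨C, hC, hb⟩ := hb
  refine ⟨C, hC, fun n f F H hF hH hosc => ?_⟩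
  have h1 := hF.lift_reflect
  have h2 := hH.lift_reflect
  have h3 := hosc.reflect
  rw [neg_neg, neg_neg] at h1 h2 h3
  have := (hb n _ _ _ h1 (by simpa using h2) h3).reflect
  simpa using this

theorem UniformlyBounded.glue {h : ℕ → ℝ → ℝ} {u v w : EReal} (h1 : UniformlyBounded h u v)
    (h2 : UniformlyBounded h v w) (huv : u ≤ v) (hvw : v ≤ w) : UniformlyBounded h u w := by
  obtain ⟨C, hC, h1⟩ := h1
  obtain ⟨D, hD, h2⟩ := h2
  refine ⟨C + D, add_nonneg hC hD, fun n f F H hF hH hosc => ?_⟩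
  exact (h1 n f F H (hF.mono le_rfl hvw) (hH.mono le_rfl hvw) (hosc.mono le_rfl hvw)).glue
    (h2 n f F H (hF.mono huv le_rfl) (hH.mono huv le_rfl) (hosc.mono huv le_rfl)) huv hvw

theorem uniformlyBounded_self (h : ℕ → ℝ → ℝ) (a : EReal) : UniformlyBounded h a a := by
  refine ⟨0, le_rfl, fun n f F H _ _ _ x y h1 h2 h3 h4 => ?_⟩
  rw [le_antisymm h2 h1, le_antisymm h4 h3]
  simp

theorem IsPrim.sub_const {φ F : EReal → ℝ} {a b : EReal} (h : IsPrim φ F a b) (c : ℝ) :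
    IsPrim φ (fun x => F x - c) a b := by
  simpa only [IsPrim, sub_sub_sub_cancel_right] using h

theorem isPrim_lift_sum {ι : Type*} (s : Finset ι) {f : ι → ℝ → ℝ} {F : ι → EReal → ℝ}
    {a b : EReal} (h : ∀ i ∈ s, IsPrim (lift (f i)) (F i) a b) :
    IsPrim (lift fun x => ∑ i ∈ s, f i x) (fun x => ∑ i ∈ s, F i x) a b := by
  classical
  induction s using Finset.induction_on with
  | empty => exact isPrim_lift_zero 0 (by simp) (by simp)
  | insert i s hi ih =>
    have := (h i (by simp)).lift_add (ih fun j hj => h j (by simp [hj]))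
    simpa only [Finset.sum_insert hi] using this

/-! ### Gliding hump and uniform boundedness -/

/-- A series of functions which live on intervals shrinking to `p` and whose Alexiewicz norms decay
geometrically is integrable. -/
theorem exists_isPrim_series {p b : EReal} (hpb : p < b) {D : ℕ → EReal}
    (hD : StrictAnti D) (hDp : Tendsto D atTop (𝓝 p)) {f : ℕ → ℝ → ℝ} {F : ℕ → EReal → ℝ}
    (hF : ∀ k, IsPrim (lift (f k)) (F k) (D (k + 1)) (D k))
    (hosc : ∀ k, OscLe (F k) (D (k + 1)) (D k) 1) :
    ∃ g G, IsPrim (lift g) G p b ∧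
      ∀ k, ∀ x : ℝ, D (k + 1) < x → x < D k → g x = (1 / 2) ^ k * f k x := by
  classical
  have hlt : ∀ k, D (k + 1) < D k := fun k => hD (Nat.lt_succ_self k)
  set f' : ℕ → ℝ → ℝ := fun k x =>
    if D (k + 1) < x ∧ (x : EReal) < D k then (1 / 2) ^ k * f k x else 0
  -- Normalised to vanish from `D k` on, so that to the right of any `c > p` only finitely many
  -- terms survive.
  set G : ℕ → EReal → ℝ := fun k x =>
    (1 / 2) ^ k * (F k (max (D (k + 1)) (min x (D k))) - F k (D k))
  have hG0 : ∀ k x, D k ≤ x → G k x = 0 := by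
    intro k x hx
    simp [G, min_eq_right hx, max_eq_right (hlt k).le]
  have hGle : ∀ k x, ‖G k x‖ ≤ (1 / 2) ^ k := by
    intro k x
    rw [Real.norm_eq_abs, abs_mul, abs_of_pos (by positivity : (0 : ℝ) < (1 / 2) ^ k)]
    exact mul_le_of_le_one_right (by positivity) (hosc k _ _ (hlt k).le le_rfl (le_max_left _ _)
      (max_le (hlt k).le (min_le_right _ _)))
  have hGc : ∀ k, Continuous (G k) := by
    intro k
    refine continuous_const.mul (Continuous.sub ?_ continuous_const)
    exact (hF k).lift_continuousOn.comp_continuous (by fun_prop)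
      fun x => ⟨le_max_left _ _, max_le (hlt k).le (min_le_right _ _)⟩
  have hprim : ∀ k c, IsPrim (lift (f' k)) (G k) c b := by
    intro k c
    have := (((hF k).lift_const_mul ((1 / 2) ^ k)).extend (a := c) (b := b) (g := f' k) (hlt k).le
      (fun x h1 h2 => by simp [f', h1, h2]) (fun x hx => by simp [f', hx.not_gt])
      (fun x hx => by simp [f', hx.not_gt])).sub_const ((1 / 2) ^ k * F k (D k))
    simpa only [← mul_sub] using this
  refine ⟨fun x => ∑' k, f' k x, fun x => ∑' k, G k x, ?_, fun k x h1 h2 => ?_⟩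
  · refine isPrim_of_forall_lt hpb (by simp) (by simp) (fun c hpc hcb => ?_) ?_
    · obtain ⟨K, hK⟩ := (hDp.eventually_lt_const hpc).exists
      have hDK : ∀ k ∉ Finset.range K, D k < c := fun k hk =>
        (hD.antitone (by simpa using hk)).trans_lt hK
      refine (isPrim_lift_sum (Finset.range K) fun k _ => hprim k c).lift_congr
        (fun x hx _ => ?_) fun t ht _ => ?_
      · refine (tsum_eq_sum fun k hk => ?_).symm
        have : ¬ ((x : EReal) < D k) := ((hDK k hk).trans hx).not_gt
        simp [f', this]
      · exact (tsum_eq_sum fun k hk => hG0 k t ((hDK k hk).le.trans ht)).symm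
    -- Hake's theorem asks only for continuity at `p`, which the Weierstrass test provides.
    · exact (continuous_tsum hGc summable_geometric_two hGle).continuousWithinAt
  · simp only
    rw [tsum_eq_single k]
    · simp [f', h1, h2]
    · intro j hj
      rcases lt_or_gt_of_ne hj with h | h
      · have : ¬ (D (j + 1) < (x : EReal)) := (h2.le.trans (hD.antitone h)).not_gt
        simp [f', this]
      · have : ¬ ((x : EReal) < D j) := ((hD.antitone h).trans h1.le).not_gt
        simp [f', this]

/-- The primitive `H` of a bad product is continuous at `p`, so its large oscillation survives
cutting the interval at some `c` just right of `p`. The extra bound `c < e` later forces the humps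
to shrink to `p`. -/
theorem exists_large_osc {h : ℕ → ℝ → ℝ} {p d e : EReal} (hpd : p < d) (hpe : p < e)
    (hb : ¬ UniformlyBounded h p d) {K : ℝ} (hK : 0 ≤ K) :
    ∃ c, p < c ∧ c < d ∧ c < e ∧ ∃ n f F H x y, IsPrim (lift f) F c d ∧
      IsPrim (lift fun x => f x * h n x) H c d ∧ OscLe F c d 1 ∧
      c ≤ x ∧ x ≤ d ∧ c ≤ y ∧ y ≤ d ∧ K < |H y - H x| := by
  simp only [UniformlyBounded, MulBound, OscLe, not_exists, not_and, not_forall, not_le] at hb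
  obtain ⟨n, f, F, H, hF, hH, hosc, x, y, hx, hx', hy, hy', hlt⟩ := hb K hK
  have hcont : ∀ w, p ≤ w → w ≤ d →
      ContinuousWithinAt (fun z => H (max w z)) (Set.Icc p d) p := by
    intro w hw hw'
    exact (hH.lift_continuousOn.comp (f := fun z => max w z) (by fun_prop)
      fun z hz => ⟨hz.1.trans (le_max_right _ _), max_le hw' hz.2⟩) p ⟨le_rfl, hpd.le⟩
  have h1 : ∀ᶠ z in 𝓝[Set.Icc p d] p, K < |H (max y z) - H (max x z)| := by
    refine Tendsto.eventually_const_lt (v := |H y - H x|) hlt ?_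
    have := ((hcont y hy hy').sub (hcont x hx hx')).abs
    simpa [ContinuousWithinAt, max_eq_left hx, max_eq_left hy] using this
  have h2 : ∀ᶠ z in 𝓝[>] p, z < min d e := Ioo_mem_nhdsGT (lt_min hpd hpe) |> fun h =>
    mem_of_superset h fun z hz => hz.2
  have h3 : 𝓝[Set.Ioo p d] p ≤ 𝓝[Set.Icc p d] p := nhdsWithin_mono _ Set.Ioo_subset_Icc_self
  rw [nhdsWithin_Ioo_eq_nhdsGT hpd] at h3
  have : (𝓝[>] p).NeBot := nhdsGT_neBot_of_exists_gt ⟨d, hpd⟩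
  obtain ⟨z, ⟨hz1, hz2⟩, hz3⟩ := ((h1.filter_mono h3).and h2 |>.and self_mem_nhdsWithin).exists
  have hzd := (hz2.trans_le (min_le_left _ _)).le
  exact ⟨z, hz3, hz2.trans_le (min_le_left _ _), hz2.trans_le (min_le_right _ _), n, f, F, H,
    max x z, max y z, hF.mono (le_of_lt hz3) le_rfl, hH.mono (le_of_lt hz3) le_rfl,
    fun x y h1 h2 h3 h4 => hosc x y ((le_of_lt hz3).trans h1) h2 ((le_of_lt hz3).trans h3) h4,
    le_max_right _ _, max_le hx' hzd, le_max_right _ _, max_le hy' hzd, hz1⟩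

theorem PointwiseBounded.exists_right {h : ℕ → ℝ → ℝ} {p b : EReal}
    (hb : PointwiseBounded h p b) (hpb : p < b) : ∃ d, p < d ∧ d ≤ b ∧ UniformlyBounded h p d := by
  by_contra! hcon
  obtain ⟨q, -, hq, hqp⟩ := exists_seq_strictAnti_tendsto' hpb
  have step : ∀ (k : ℕ) (d : {d : EReal // p < d ∧ d ≤ b}), ∃ c : {d : EReal // p < d ∧ d ≤ b},
      c.1 < d.1 ∧ c.1 < q k ∧ ∃ n f F H x y, IsPrim (lift f) F c.1 d.1 ∧
      IsPrim (lift fun x => f x * h n x) H c.1 d.1 ∧ OscLe F c.1 d.1 1 ∧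
      c.1 ≤ x ∧ x ≤ d.1 ∧ c.1 ≤ y ∧ y ≤ d.1 ∧ (4 : ℝ) ^ k < |H y - H x| := by
    rintro k ⟨d, hd, hd'⟩
    -- The threshold `4 ^ k` beats the weight `(1 / 2) ^ k` in the series, leaving oscillations
    -- above `2 ^ k`.
    obtain ⟨c, h1, h2, h3, h4⟩ := exists_large_osc hd (hq k).1 (hcon d hd hd')
      (by positivity : (0 : ℝ) ≤ 4 ^ k)
    exact ⟨⟨c, h1, h2.le.trans hd'⟩, h2, h3, h4⟩
  choose next hnext1 hnext2 hnext3 using step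
  set D' : ℕ → {d : EReal // p < d ∧ d ≤ b} := fun k => Nat.rec ⟨b, hpb, le_rfl⟩ next k
  set D : ℕ → EReal := fun k => (D' k).1
  have hD : StrictAnti D := strictAnti_nat_of_succ_lt fun k => hnext1 k (D' k)
  have hDp : Tendsto D atTop (𝓝 p) := by
    rw [← tendsto_add_atTop_iff_nat 1]
    exact tendsto_of_tendsto_of_tendsto_of_le_of_le tendsto_const_nhds hqp
      (fun k => (D' (k + 1)).2.1.le) fun k => (hnext2 k (D' k)).le
  have hstep : ∀ k, ∃ n f F H x y, IsPrim (lift f) F (D (k + 1)) (D k) ∧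
      IsPrim (lift fun x => f x * h n x) H (D (k + 1)) (D k) ∧ OscLe F (D (k + 1)) (D k) 1 ∧
      D (k + 1) ≤ x ∧ x ≤ D k ∧ D (k + 1) ≤ y ∧ y ≤ D k ∧ (4 : ℝ) ^ k < |H y - H x| :=
    fun k => hnext3 k (D' k)
  choose n f F H x y hF hH hosc hx hx' hy hy' hlt using hstep
  obtain ⟨g, G, hG, hg⟩ := exists_isPrim_series hpb hD hDp hF hosc
  obtain ⟨B, hB⟩ := hb g G hG
  obtain ⟨k, hk⟩ := pow_unbounded_of_one_lt B (one_lt_two (α := ℝ))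
  obtain ⟨J, hJ, hJB⟩ := hB (n k)
  have hJ' := (hJ.mono (D' (k + 1)).2.1.le (D' k).2.2).lift_congr
    (g := fun x => (1 / 2) ^ k * (f k x * h (n k) x))
    (fun x h1 h2 => by rw [hg k x h1 h2, mul_assoc]) fun _ _ _ => rfl
  have e := hJ'.unique ((hH k).lift_const_mul ((1 / 2) ^ k)) (hx k) (hx' k) (hy k) (hy' k)
  have e1 := hJB (x k) (y k) ((D' (k + 1)).2.1.le.trans (hx k)) ((hx' k).trans (D' k).2.2)
    ((D' (k + 1)).2.1.le.trans (hy k)) ((hy' k).trans (D' k).2.2)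
  rw [e, ← mul_sub, abs_mul, abs_of_pos (by positivity : (0 : ℝ) < (1 / 2) ^ k)] at e1
  have e2 := mul_lt_mul_of_pos_left (hlt k) (by positivity : (0 : ℝ) < (1 / 2) ^ k)
  rw [← mul_pow] at e2
  norm_num at e2 e1
  linarith

theorem PointwiseBounded.exists_left {h : ℕ → ℝ → ℝ} {a p : EReal}
    (hb : PointwiseBounded h a p) (hap : a < p) : ∃ c, c < p ∧ a ≤ c ∧ UniformlyBounded h c p := by
  obtain ⟨d, h1, h2, h3⟩ := hb.reflect.exists_right (EReal.neg_lt_neg_iff.2 hap)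
  have := h3.reflect
  simp only [neg_neg] at this
  exact ⟨-d, EReal.neg_lt_of_neg_lt h1, EReal.le_neg_of_le_neg h2, this⟩

/-- The uniform boundedness principle for sequences of multipliers. -/
theorem PointwiseBounded.uniformlyBounded {h : ℕ → ℝ → ℝ} {a b : EReal} (hab : a ≤ b)
    (hb : PointwiseBounded h a b) : UniformlyBounded h a b := by
  refine cousin_induction hab (uniformlyBounded_self h a)
    (fun u v w _ huv hvw _ h1 h2 => h1.glue h2 huv.le hvw.le) fun t hat htb => ?_
  have hl : ∀ᶠ u in 𝓝 t, a ≤ u → u ≤ t → UniformlyBounded h u t := by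
    rcases hat.eq_or_lt with rfl | hat'
    · refine Eventually.of_forall fun u h1 h2 => ?_
      rw [le_antisymm h2 h1]
      exact uniformlyBounded_self h a
    · obtain ⟨c, hc, -, hu⟩ := (hb.mono le_rfl hat htb).exists_left hat'
      filter_upwards [eventually_gt_nhds hc] with u hcu _ hut
      exact hu.mono hcu.le hut le_rfl
  have hr : ∀ᶠ v in 𝓝 t, t ≤ v → v ≤ b → UniformlyBounded h t v := by
    rcases htb.eq_or_lt with rfl | htb'
    · refine Eventually.of_forall fun u h1 h2 => ?_
      rw [le_antisymm h2 h1]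
      exact uniformlyBounded_self h t
    · obtain ⟨d, hd, -, hu⟩ := (hb.mono hat htb le_rfl).exists_right htb'
      filter_upwards [eventually_lt_nhds hd] with v hvd htv _
      exact hu.mono le_rfl htv hvd.le
  filter_upwards [(continuous_fst.tendsto (t, t)).eventually hl,
    (continuous_snd.tendsto (t, t)).eventually hr] with q h1 h2 h3 h4 h5 h6 _
  exact (h1 h3 h4).glue (h2 h5 h6) h4 h5

theorem MulBound.oscLe {h : ℕ → ℝ → ℝ} {C : ℝ} {a b : EReal} (hb : MulBound h C a b) {n : ℕ}
    {f : ℝ → ℝ} {F H : EReal → ℝ} {δ : ℝ} (hδ : 0 < δ) (hF : IsPrim (lift f) F a b)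
    (hH : IsPrim (lift fun x => f x * h n x) H a b) (hosc : OscLe F a b δ) :
    OscLe H a b (δ * C) := by
  have h2 := hH.lift_const_mul δ⁻¹
  simp only [← mul_assoc] at h2
  have h3 := hosc.const_mul (inv_nonneg.2 hδ.le)
  rw [inv_mul_cancel₀ hδ.ne'] at h3
  simpa [mul_inv_cancel_left₀ hδ.ne'] using
    (hb n _ _ _ (hF.lift_const_mul δ⁻¹) h2 h3).const_mul hδ.le

theorem oscLe_coe {F : EReal → ℝ} {c d : ℝ} {C : ℝ}
    (h : ∀ x y : ℝ, c ≤ x → x ≤ y → y ≤ d → |F y - F x| ≤ C) : OscLe F c d C := by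
  intro x y hx hx' hy hy'
  lift x to ℝ using ⟨(hx'.trans_lt (EReal.coe_lt_top d)).ne, ((EReal.bot_lt_coe c).trans_le hx).ne'⟩
  lift y to ℝ using ⟨(hy'.trans_lt (EReal.coe_lt_top d)).ne, ((EReal.bot_lt_coe c).trans_le hy).ne'⟩
  rw [EReal.coe_le_coe_iff] at hx hx' hy hy'
  rcases le_total x y with hxy | hxy
  · exact h x y hx hxy hy'
  · rw [abs_sub_comm]
    exact h y x hy hxy hx'

/-! ### Almost everywhere differentiation of primitives -/

theorem lintegral_deriv_le_of_monotone {w : ℝ → ℝ} (hw : Monotone w) {c d ε : ℝ} (hcd : c ≤ d)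
    (hε : w d - w c ≤ ε) :
    ∫⁻ x in Set.Ioc c d, ENNReal.ofReal (deriv w x) ≤ ENNReal.ofReal ε := by
  have h1 := (hw.monotoneOn (Set.uIcc c d)).intervalIntegrable_deriv
  have h2 := (hw.monotoneOn (Set.uIcc c d)).intervalIntegral_deriv_mem_uIcc
  rw [Set.uIcc_of_le (sub_nonneg.2 (hw hcd)), intervalIntegral.integral_of_le hcd] at h2
  rw [intervalIntegrable_iff_integrableOn_Ioc_of_le hcd] at h1
  rw [← ofReal_integral_eq_lintegral_ofReal h1 (Eventually.of_forall fun x => hw.deriv_nonneg)]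
  exact ENNReal.ofReal_le_ofReal (h2.2.trans hε)

/-- A Henstock--Kurzweil primitive has almost everywhere no derivative other than the integrand. -/
theorem IsPrim.ae_deriv_eq {f : ℝ → ℝ} {F : EReal → ℝ} {c d : ℝ}
    (h : IsPrim (lift f) F c d) :
    ∀ᵐ x : ℝ, x ∈ Set.Ioo c d → DifferentiableAt ℝ (fun y : ℝ => F y) x →
      deriv (fun y : ℝ => F y) x = f x := by
  rcases le_or_gt d c with hdc | hcd
  · simp [Set.Ioo_eq_empty hdc.not_gt]
  -- The difference between the integrand and the derivative is bounded by every `deriv (W k)`. The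
  -- integral of that derivative is at most `(1 / 2) ^ k`, so the infimum over `k` vanishes almost
  -- everywhere.
  choose W hW hW' hloc using fun k : ℕ => h ((1 / 2) ^ k) (by positivity)
  set w : ℕ → ℝ → ℝ := fun k x => W k x
  have hw : ∀ k, Monotone (w k) := fun k x y hxy => hW k (EReal.coe_le_coe_iff.2 hxy)
  set g : ℕ → ℝ → ENNReal := fun k x => ENNReal.ofReal (deriv (w k) x)
  have hg : ∀ k, Measurable (g k) := fun k => (measurable_deriv _).ennreal_ofReal
  have hgi : ∫⁻ x in Set.Ioc c d, ⨅ k, g k x = 0 := by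
    have : ∀ k : ℕ, ∫⁻ x in Set.Ioc c d, ⨅ k, g k x ≤ ENNReal.ofReal ((1 / 2) ^ k) := fun k =>
      (lintegral_mono fun x => iInf_le _ k).trans (lintegral_deriv_le_of_monotone (hw k) hcd.le
        (by linarith [(hW' k d).2, (hW' k c).1]))
    have h2 : Tendsto (fun k : ℕ => ENNReal.ofReal ((1 / 2 : ℝ) ^ k)) atTop (𝓝 0) := by
      rw [← ENNReal.ofReal_zero]
      exact (ENNReal.continuous_ofReal.tendsto 0).comp
        (tendsto_pow_atTop_nhds_zero_of_lt_one (by norm_num) (by norm_num))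
    exact le_antisymm (ge_of_tendsto' h2 this) zero_le
  rw [lintegral_eq_zero_iff (Measurable.iInf hg), EventuallyEq,
    ae_restrict_iff' measurableSet_Ioc] at hgi
  filter_upwards [hgi, ae_all_iff.2 fun k => (hw k).ae_differentiableAt] with x hx hdiff hxm hF
  have key : ∀ k, |f x - deriv (fun y : ℝ => F y) x| ≤ deriv (w k) x := by
    intro k
    have e : Tendsto (fun v : ℝ => ((x : EReal), (v : EReal))) (𝓝[>] x)
        (𝓝 ((x : EReal), (x : EReal))) :=
      ((continuous_const.prodMk continuous_coe_real_ereal).tendsto x).mono_left nhdsWithin_le_nhds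
    have h1 := e.eventually (hloc k x (EReal.coe_le_coe_iff.2 hxm.1.le)
      (EReal.coe_le_coe_iff.2 hxm.2.le))
    have h2 : ∀ᶠ v in 𝓝[>] x, v < d := mem_of_superset (Ioo_mem_nhdsGT hxm.2) fun v hv => hv.2
    have h3 : ∀ {φ : ℝ → ℝ}, DifferentiableAt ℝ φ x →
        Tendsto (slope φ x) (𝓝[>] x) (𝓝 (deriv φ x)) := fun hφ =>
      (hasDerivAt_iff_tendsto_slope.1 hφ.hasDerivAt).mono_left
        (nhdsWithin_mono _ fun y hy => ne_of_gt hy)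
    refine le_of_tendsto_of_tendsto ((tendsto_const_nhds.sub (h3 hF)).abs) (h3 (hdiff k)) ?_
    filter_upwards [h1, h2, self_mem_nhdsWithin] with v hv hvd hxv
    have hxv' : 0 < v - x := sub_pos.2 hxv
    have := hv (EReal.coe_le_coe_iff.2 hxm.1.le) le_rfl (EReal.coe_le_coe_iff.2 (le_of_lt hxv))
      (EReal.coe_le_coe_iff.2 hvd.le)
    simp only [lift_coe, EReal.toReal_coe] at this
    rw [slope_def_field, slope_def_field, le_div_iff₀ hxv']
    calc _ = |f x * (v - x) - (F v - F x)| := by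
          nth_rw 2 [← abs_of_pos hxv']
          rw [← abs_mul]
          congr 1
          field_simp
      _ ≤ _ := this
  have h0 : ENNReal.ofReal |f x - deriv (fun y : ℝ => F y) x| ≤ 0 := by
    have := hx ⟨hxm.1, hxm.2.le⟩
    simp only [Pi.zero_apply] at this
    rw [← this]
    exact le_iInf fun k => ENNReal.ofReal_le_ofReal (key k)
  have h1 := abs_nonpos_iff.1 (ENNReal.ofReal_eq_zero.1 (le_antisymm h0 zero_le))
  linarith

/-- Primitives which are uniformly Lipschitz converge to constants if the integrands converge to
zero almost everywhere. -/
theorem eventually_oscLe_of_lipschitz {h : ℕ → ℝ → ℝ} {H : ℕ → EReal → ℝ} {c d C : ℝ}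
    (hcd : c ≤ d) (hC : 0 ≤ C)
    (hH : ∀ n, IsPrim (lift (h n)) (H n) c d)
    (hlip : ∀ n, ∀ x y : ℝ, c ≤ x → x ≤ y → y ≤ d → |H n y - H n x| ≤ C * (y - x))
    (hae : ∀ᵐ x : ℝ, x ∈ Set.Ioo c d → Tendsto (fun n => h n x) atTop (𝓝 0)) {ε : ℝ}
    (hε : 0 < ε) : ∀ᶠ n in atTop, OscLe (H n) c d ε := by
  lift C to NNReal using hC
  set R : ℕ → ℝ → ℝ := fun n x => H n x
  have hR : ∀ n, LipschitzOnWith C (R n) (Set.Icc c d) := by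
    refine fun n => LipschitzOnWith.of_dist_le_mul fun x hx y hy => ?_
    rw [Real.dist_eq, Real.dist_eq]
    rcases le_total x y with hxy | hxy
    · rw [abs_sub_comm, abs_sub_comm x, abs_of_nonneg (sub_nonneg.2 hxy)]
      exact hlip n x y hx.1 hxy hy.2
    · rw [abs_of_nonneg (sub_nonneg.2 hxy)]
      exact hlip n y x hy.1 hxy hx.2
  have hac : ∀ n, AbsolutelyContinuousOnInterval (R n) c d := fun n =>
    LipschitzOnWith.absolutelyContinuousOnInterval (K := C) (by rw [Set.uIcc_of_le hcd]; exact hR n)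
  have hne : ∀ᵐ x : ℝ, x ≠ d := Measure.ae_ne volume d
  -- The Lipschitz constant dominates the derivatives, which agree almost everywhere with `h n`.
  have hlim : Tendsto (fun n => ∫ x in c..d, ‖deriv (R n) x‖) atTop (𝓝 (∫ x in c..d, (0 : ℝ))) := by
    refine intervalIntegral.tendsto_integral_filter_of_dominated_convergence (fun _ => (C : ℝ))
      (Eventually.of_forall fun n => (measurable_deriv _).norm.aestronglyMeasurable)
      (Eventually.of_forall fun n => ?_) intervalIntegrable_const ?_
    · filter_upwards [hne] with x hx hxm
      rw [Set.uIoc_of_le hcd] at hxm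
      rw [norm_norm]
      exact norm_deriv_le_of_lipschitzOn (Icc_mem_nhds hxm.1 (lt_of_le_of_ne hxm.2 hx)) (hR n)
    · filter_upwards [hne, hae, ae_all_iff.2 fun n => (hH n).ae_deriv_eq,
        ae_all_iff.2 fun n => (hac n).ae_differentiableAt] with x hx h1 h2 h3 hxm
      rw [Set.uIoc_of_le hcd] at hxm
      have hxm' : x ∈ Set.Ioo c d := ⟨hxm.1, lt_of_le_of_ne hxm.2 hx⟩
      have : ∀ n, deriv (R n) x = h n x := fun n =>
        h2 n hxm' (h3 n (by rw [Set.uIcc_of_le hcd]; exact ⟨hxm.1.le, hxm.2⟩))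
      simp only [this]
      simpa using (h1 hxm').norm
  rw [intervalIntegral.integral_zero] at hlim
  filter_upwards [hlim.eventually_lt_const hε] with n hn
  refine oscLe_coe fun x y hx hxy hy => ?_
  have h1 := ((hac n).mono (c := x) (d := y) (by
    rw [Set.uIcc_of_le hxy, Set.uIcc_of_le hcd]
    exact Set.Icc_subset_Icc hx hy)).integral_deriv_eq_sub
  calc |H n y - H n x| = ‖∫ t in x..y, deriv (R n) t‖ := by rw [h1, Real.norm_eq_abs]
    _ ≤ ∫ t in x..y, ‖deriv (R n) t‖ := intervalIntegral.norm_integral_le_integral_norm hxy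
    _ ≤ ∫ t in c..d, ‖deriv (R n) t‖ := intervalIntegral.integral_mono_interval hx hxy hy
        (Eventually.of_forall fun t => norm_nonneg _) (hac n).intervalIntegrable_deriv.norm
    _ ≤ ε := hn.le

theorem OscLe.of_isPrim {f : ℝ → ℝ} {F G : EReal → ℝ} {a b : EReal} {C : ℝ}
    (h : OscLe F a b C) (hF : IsPrim (lift f) F a b) (hG : IsPrim (lift f) G a b) :
    OscLe G a b C := fun x y h1 h2 h3 h4 => by
  rw [← hF.unique hG h1 h2 h3 h4]
  exact h x y h1 h2 h3 h4

/-! ### Strong convergence of the multipliers to zero -/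

/-- The products of `s` with the `h n` tend to zero in the Alexiewicz norm on `(a, b)`. -/
def Annihilates (h : ℕ → ℝ → ℝ) (s : ℝ → ℝ) (a b : EReal) : Prop :=
  ∀ ε : ℝ, 0 < ε → ∀ᶠ n in atTop, ∀ H, IsPrim (lift fun x => s x * h n x) H a b → OscLe H a b ε

theorem Annihilates.glue {h : ℕ → ℝ → ℝ} {s : ℝ → ℝ} {u v w : EReal} (h1 : Annihilates h s u v)
    (h2 : Annihilates h s v w) (huv : u ≤ v) (hvw : v ≤ w) : Annihilates h s u w := by
  intro ε hε
  filter_upwards [h1 _ (half_pos hε), h2 _ (half_pos hε)] with n e1 e2 H hH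
  have := (e1 H (hH.mono le_rfl hvw)).glue (e2 H (hH.mono huv le_rfl)) huv hvw
  rwa [add_halves] at this

theorem Annihilates.congr {h : ℕ → ℝ → ℝ} {s r : ℝ → ℝ} {a b : EReal} (h1 : Annihilates h s a b)
    (hs : ∀ x : ℝ, a < x → x < b → s x = r x) : Annihilates h r a b := by
  intro ε hε
  filter_upwards [h1 ε hε] with n e1 H hH
  exact e1 H (hH.lift_congr (fun x k1 k2 => by rw [hs x k1 k2]) fun _ _ _ => rfl)

theorem PointwiseBounded.exists_isPrim_coe {h : ℕ → ℝ → ℝ} {c d : ℝ}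
    (hb : PointwiseBounded h c d) (n : ℕ) : ∃ H, IsPrim (lift (h n)) H c d := by
  obtain ⟨B, hB⟩ := hb _ _ (isPrim_lift_one c d)
  obtain ⟨H, hH, -⟩ := hB n
  exact ⟨H, by simpa using hH⟩

theorem PointwiseBounded.annihilates_step {h : ℕ → ℝ → ℝ} {u v : EReal} {c d : ℝ} (k : ℝ)
    (hb : PointwiseBounded h u v) (huc : u ≤ c) (hcd : c < d) (hdv : d ≤ v)
    (hae : ∀ᵐ x : ℝ, x ∈ Set.Ioo c d → Tendsto (fun n => h n x) atTop (𝓝 0)) {s : ℝ → ℝ}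
    (hs : ∀ x ∈ Set.Ioo c d, s x = k) (hl : ∀ x < c, s x = 0) (hr : ∀ x > d, s x = 0) :
    Annihilates h s u v := by
  have hcd' : (c : EReal) ≤ d := EReal.coe_le_coe_iff.2 hcd.le
  have hb' := hb.mono huc hcd' hdv
  obtain ⟨C, hC, hM⟩ := hb'.uniformlyBounded hcd'
  choose H hH using hb'.exists_isPrim_coe
  intro ε hε
  have hk : 0 < |k| + 1 := by positivity
  have := eventually_oscLe_of_lipschitz hcd.le hC hH (fun n x y hx hxy hy => ?_) hae
    (div_pos hε hk)
  · filter_upwards [this] with n hn J hJ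
    have h1 := ((hH n).lift_const_mul k).extend (a := u) (b := v) (g := fun x => s x * h n x) hcd'
      (fun x h1 h2 => by rw [hs x ⟨EReal.coe_lt_coe_iff.1 h1, EReal.coe_lt_coe_iff.1 h2⟩])
      (fun x h1 => by rw [hl x (EReal.coe_lt_coe_iff.1 h1), zero_mul])
      (fun x h1 => by rw [hr x (EReal.coe_lt_coe_iff.1 h1), zero_mul])
    refine OscLe.of_isPrim ?_ h1 hJ
    refine OscLe.clamp (F := fun x => k * H n x) (fun x y h1 h2 h3 h4 => ?_) hcd'
    have h5 := hn x y h1 h2 h3 h4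
    rw [le_div_iff₀ hk] at h5
    rw [← mul_sub, abs_mul]
    nlinarith [abs_nonneg (H n y - H n x)]
  -- The constant 1 has norm `y - x` on `[x, y]`, so the uniform bound is a Lipschitz bound for the
  -- primitive of `h n`.
  · rcases hxy.eq_or_lt with rfl | hlt
    · simp
    have e1 := hM.mono (EReal.coe_le_coe_iff.2 hx) (EReal.coe_le_coe_iff.2 hxy)
      (EReal.coe_le_coe_iff.2 hy)
    have e2 := (hH n).mono (EReal.coe_le_coe_iff.2 hx) (EReal.coe_le_coe_iff.2 hy)
    have e3 : OscLe EReal.toReal x y (y - x) := oscLe_coe fun z w h1 h2 h3 => by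
      simp only [EReal.toReal_coe]
      rw [abs_of_nonneg (sub_nonneg.2 h2)]
      linarith
    have := e1.oscLe (n := n) (sub_pos.2 hlt) (isPrim_lift_one x y) (by simpa using e2) e3 x y
      le_rfl (EReal.coe_le_coe_iff.2 hxy) (EReal.coe_le_coe_iff.2 hxy) le_rfl
    rwa [mul_comm]

/-- Primitives are uniformly approximated by those of step functions, which are annihilated. -/
theorem PointwiseBounded.exists_approx {h : ℕ → ℝ → ℝ} {a b : EReal} (hab : a ≤ b)
    (hb : PointwiseBounded h a b)
    (hae : ∀ᵐ x : ℝ, a < (x : EReal) → (x : EReal) < b → Tendsto (fun n => h n x) atTop (𝓝 0))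
    {F : EReal → ℝ} (hF : ContinuousOn F (Set.Icc a b)) {η : ℝ} (hη : 0 < η) :
    ∃ s S, IsPrim (lift s) S a b ∧ S a = F a ∧ S b = F b ∧
      (∀ x, a ≤ x → x ≤ b → |F x - S x| ≤ η) ∧ Annihilates h s a b := by
  classical
  -- Exact agreement with `F` at both endpoints lets neighbouring approximations be joined
  -- continuously.
  refine cousin_induction (Q := fun u v => ∃ s S, IsPrim (lift s) S u v ∧ S u = F u ∧ S v = F v ∧
      (∀ x, u ≤ x → x ≤ v → |F x - S x| ≤ η) ∧ Annihilates h s u v) hab ?_ ?_ ?_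
  · refine ⟨fun _ => 0, fun _ => F a, isPrim_lift_zero (F a) (by simp) (by simp), rfl, rfl,
      fun x h1 h2 => ?_, fun ε hε => Eventually.of_forall fun n H _ x y h1 h2 h3 h4 => ?_⟩
    · rw [le_antisymm h2 h1]; simpa using hη.le
    · rw [le_antisymm h2 h1, le_antisymm h4 h3]; simpa using hε.le
  · rintro u v w - huv hvw - ⟨s, S, hS, hSu, hSv, hSF, hs⟩ ⟨r, R, hR, hRv, hRw, hRF, hr⟩
    have e1 : ∀ x : ℝ, (x : EReal) < v → s x = if (x : EReal) < v then s x else r x :=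
      fun x hx => by simp [hx]
    have e2 : ∀ x : ℝ, v < (x : EReal) → r x = if (x : EReal) < v then s x else r x :=
      fun x hx => by simp [hx.not_gt]
    have e3 : ∀ t, t ≤ v → S t = if t ≤ v then S t else R t := fun t ht => by simp [ht]
    have e4 : ∀ t, v ≤ t → R t = if t ≤ v then S t else R t := fun t ht => by
      split_ifs with h
      · rw [le_antisymm h ht, hSv, hRv]
      · rfl
    refine ⟨fun x => if (x : EReal) < v then s x else r x, fun t => if t ≤ v then S t else R t,
      (hS.lift_congr (fun x _ hx => e1 x hx) fun t _ ht => e3 t ht).glue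
        (hR.lift_congr (fun x hx _ => e2 x hx) fun t ht _ => e4 t ht), ?_, ?_, fun x h1 h2 => ?_,
      (hs.congr fun x _ hx => e1 x hx).glue (hr.congr fun x hx _ => e2 x hx) huv.le hvw.le⟩
    · exact (e3 u huv.le).symm.trans hSu
    · exact (e4 w hvw.le).symm.trans hRw
    · rcases le_total x v with h | h
      · simp only [← e3 x h]; exact hSF x h1 h
      · simp only [← e4 x h]; exact hRF x h h2
  · intro t hat htb
    have h1 : {x | x ∈ Set.Icc a b → |F x - F t| < η / 2} ∈ 𝓝 t := by
      have := Metric.tendsto_nhds.1 (hF t ⟨hat, htb⟩) (η / 2) (half_pos hη)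
      rwa [eventually_nhdsWithin_iff] at this
    obtain ⟨l, r, -, hlr, hsub⟩ := exists_Icc_mem_subset_of_mem_nhds h1
    rw [nhds_prod_eq]
    filter_upwards [prod_mem_prod hlr hlr] with p hp hau hut htv hvb huv
    obtain ⟨u, v⟩ := p
    simp only at hau hut htv hvb huv ⊢
    have hnear : ∀ x, u ≤ x → x ≤ v → |F x - F t| < η / 2 := fun x hx hx' =>
      hsub ⟨hp.1.1.trans hx, hx'.trans hp.2.2⟩ ⟨hau.trans hx, hx'.trans hvb⟩
    -- The endpoints `u` and `v` may be infinite, so the linear passage from `F u` to `F v` takes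
    -- place on a bounded interval `[c, d]` inside.
    obtain ⟨c, huc, hcv⟩ := EReal.lt_iff_exists_real_btwn.1 huv
    obtain ⟨d, hcd, hdv⟩ := EReal.lt_iff_exists_real_btwn.1 hcv
    have hcd' : c < d := EReal.coe_lt_coe_iff.1 hcd
    have hdc : 0 < d - c := sub_pos.2 hcd'
    set k := (F v - F u) / (d - c)
    set s : ℝ → ℝ := fun x => if c < x ∧ x < d then k else 0
    have hS := (((isPrim_lift_one c d).lift_const_mul k).extend (a := u) (b := v) (g := s) hcd.le
      (fun x h1 h2 => by simp [s, EReal.coe_lt_coe_iff.1 h1, EReal.coe_lt_coe_iff.1 h2])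
      (fun x h1 => by simp [s, (EReal.coe_lt_coe_iff.1 h1).not_gt])
      (fun x h1 => by simp [s, (EReal.coe_lt_coe_iff.1 h1).not_gt])).sub_const (k * c - F u)
    refine ⟨s, _, hS, ?_, ?_, fun x hx hx' => ?_, ?_⟩
    · simp only [min_eq_left (huc.trans hcd).le, max_eq_left huc.le, EReal.toReal_coe]
      ring
    · simp only [min_eq_right hdv.le, max_eq_right hcd.le, EReal.toReal_coe, k]
      field_simp
      ring
    · obtain ⟨z, hz⟩ : ∃ z : ℝ, (z : EReal) = max (c : EReal) (min x d) := by
        refine ⟨(max (c : EReal) (min x d)).toReal, EReal.coe_toReal ?_ ?_⟩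
        · exact ((max_le hcd.le (min_le_right _ _)).trans_lt (EReal.coe_lt_top d)).ne
        · exact ((EReal.bot_lt_coe c).trans_le (le_max_left _ _)).ne'
      have hz1 : c ≤ z := by
        rw [← EReal.coe_le_coe_iff, hz]; exact le_max_left _ _
      have hz2 : z ≤ d := by
        rw [← EReal.coe_le_coe_iff, hz]; exact max_le hcd.le (min_le_right _ _)
      simp only [← hz, EReal.toReal_coe]
      -- The approximant is a convex combination of `F u` and `F v`, both within `η` of `F x`.
      set θ := (z - c) / (d - c)
      have hθ : 0 ≤ θ := div_nonneg (by linarith) hdc.le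
      have hθ' : θ ≤ 1 := (div_le_one hdc).2 (by linarith)
      have e : F x - (k * z - (k * c - F u)) =
          (1 - θ) * (F x - F u) + θ * (F x - F v) := by
        simp only [k, θ]
        field_simp
        ring
      have k1 := abs_lt.1 (hnear x hx hx')
      have k2 := abs_lt.1 (hnear u le_rfl huv.le)
      have k3 := abs_lt.1 (hnear v huv.le le_rfl)
      rw [e, abs_le]
      constructor <;> nlinarith [k1.1, k1.2, k2.1, k2.2, k3.1, k3.2]
    · refine (hb.mono hau huv.le hvb).annihilates_step k huc.le hcd' hdv.le ?_
        (fun x hx => by simp [s, hx.1, hx.2]) (fun x hx => by simp [s, hx.not_gt])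
        (fun x hx => by simp [s, (show d < x from hx).not_gt])
      filter_upwards [hae] with x hx hxm
      exact hx ((hau.trans_lt huc).trans (EReal.coe_lt_coe_iff.2 hxm.1))
        ((EReal.coe_lt_coe_iff.2 hxm.2).trans (hdv.trans_le hvb))

/-- Multipliers which are pointwise bounded and tend to zero almost everywhere tend to zero
strongly. -/
theorem PointwiseBounded.annihilates {h : ℕ → ℝ → ℝ} {a b : EReal} (hab : a ≤ b)
    (hb : PointwiseBounded h a b)
    (hae : ∀ᵐ x : ℝ, a < (x : EReal) → (x : EReal) < b → Tendsto (fun n => h n x) atTop (𝓝 0))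
    {f : ℝ → ℝ} {F : EReal → ℝ} (hF : IsPrim (lift f) F a b) : Annihilates h f a b := by
  intro ε hε
  obtain ⟨C, hC, hM⟩ := hb.uniformlyBounded hab
  -- `F - S` oscillates by at most `2 * η`, so its product with `h n` costs at most `2 * η * C ≤ ε /
  -- 2`.
  set η := ε / (4 * (C + 1))
  have hη : 0 < η := by positivity
  have hηC : 2 * η * C ≤ ε / 2 := by
    have : 2 * η * (C + 1) = ε / 2 := by simp only [η]; field_simp; ring
    nlinarith
  obtain ⟨s, S, hS, -, -, hFS, hs⟩ := hb.exists_approx hab hae hF.lift_continuousOn hη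
  obtain ⟨B, hB⟩ := hb s S hS
  filter_upwards [hs _ (half_pos hε)] with n hn H hH
  obtain ⟨J, hJ, -⟩ := hB n
  have h1 : OscLe (fun x => F x - S x) a b (2 * η) := fun x y hx hx' hy hy' => by
    have k1 := abs_le.1 (hFS x hx hx')
    have k2 := abs_le.1 (hFS y hy hy')
    rw [abs_le]
    constructor <;> linarith [k1.1, k1.2, k2.1, k2.2]
  have h2 := hM.oscLe (n := n) (by positivity) (hF.lift_sub hS)
    (by simpa only [sub_mul] using hH.lift_sub hJ) h1
  intro x y hx hx' hy hy'
  have k1 := abs_le.1 (h2 x y hx hx' hy hy')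
  have k2 := abs_le.1 (hn J hJ x y hx hx' hy hy')
  rw [abs_le]
  constructor <;> linarith [k1.1, k1.2, k2.1, k2.2]

/-! ### The Alexiewicz norm as an oscillation -/

theorem IsPrim.alexiewiczNorm_le {f : ℝ → ℝ} {F : EReal → ℝ} {a b : EReal} {C : ℝ} (hab : a ≤ b)
    (hF : IsPrim (lift f) F a b) (h : OscLe F a b C) : alexiewiczNorm f a b ≤ C := by
  refine csSup_le ⟨_, a, a, le_rfl, le_rfl, hab, rfl⟩ ?_
  rintro _ ⟨c, d, hac, hcd, hdb, rfl⟩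
  rw [hF.integral_eq hac hcd hdb]
  exact h c d hac (hcd.trans hdb) (hac.trans hcd) hdb

theorem IsPrim.oscLe_alexiewiczNorm {f : ℝ → ℝ} {F : EReal → ℝ} {a b : EReal}
    (hF : IsPrim (lift f) F a b) : OscLe F a b (alexiewiczNorm f a b) := by
  obtain ⟨M, hM⟩ := isCompact_Icc.exists_bound_of_continuousOn hF.lift_continuousOn
  -- A real `sSup` is meaningful only for a bounded set; here the primitive is continuous on a
  -- compact interval.
  have hbdd : BddAbove {r : ℝ | ∃ c d : EReal, a ≤ c ∧ c ≤ d ∧ d ≤ b ∧ r = |integral f c d|} := by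
    refine ⟨M + M, ?_⟩
    rintro _ ⟨c, d, hac, hcd, hdb, rfl⟩
    rw [hF.integral_eq hac hcd hdb]
    exact (abs_sub _ _).trans (add_le_add (hM d ⟨hac.trans hcd, hdb⟩) (hM c ⟨hac, hcd.trans hdb⟩))
  have key : ∀ c d, a ≤ c → c ≤ d → d ≤ b → |F d - F c| ≤ alexiewiczNorm f a b :=
    fun c d hac hcd hdb => by
      rw [← hF.integral_eq hac hcd hdb]
      exact le_csSup hbdd ⟨c, d, hac, hcd, hdb, rfl⟩
  intro x y hx hx' hy hy'
  rcases le_total x y with h | h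
  · exact key x y hx h hy'
  · rw [abs_sub_comm]
    exact key y x hy h hx'

theorem IsPrim.alexiewiczNorm_nonneg {f : ℝ → ℝ} {F : EReal → ℝ} {a b : EReal} (hab : a ≤ b)
    (hF : IsPrim (lift f) F a b) : 0 ≤ alexiewiczNorm f a b :=
  hF.oscLe_alexiewiczNorm.nonneg hab

theorem abs_alexiewiczNorm_sub_le {f g : ℝ → ℝ} {F G : EReal → ℝ} {a b : EReal} (hab : a ≤ b)
    (hF : IsPrim (lift f) F a b) (hG : IsPrim (lift g) G a b) :
    |alexiewiczNorm f a b - alexiewiczNorm g a b| ≤ alexiewiczNorm (fun x => f x - g x) a b := by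
  have h := (hF.lift_sub hG).oscLe_alexiewiczNorm
  have h1 := hF.alexiewiczNorm_le hab (C := alexiewiczNorm g a b +
      alexiewiczNorm (fun x => f x - g x) a b) fun x y k1 k2 k3 k4 => by
    have e1 := abs_le.1 (h x y k1 k2 k3 k4)
    have e2 := abs_le.1 (hG.oscLe_alexiewiczNorm x y k1 k2 k3 k4)
    rw [abs_le]
    constructor <;> linarith [e1.1, e1.2, e2.1, e2.2]
  have h2 := hG.alexiewiczNorm_le hab (C := alexiewiczNorm f a b +
      alexiewiczNorm (fun x => f x - g x) a b) fun x y k1 k2 k3 k4 => by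
    have e1 := abs_le.1 (h x y k1 k2 k3 k4)
    have e2 := abs_le.1 (hF.oscLe_alexiewiczNorm x y k1 k2 k3 k4)
    rw [abs_le]
    constructor <;> linarith [e1.1, e1.2, e2.1, e2.2]
  rw [abs_le]
  constructor <;> linarith

/-- If the norms of the products with each integrable function converge, then the differences of
the multipliers are pointwise bounded. -/
theorem pointwiseBounded_sub {g : ℕ → ℝ → ℝ} {g₀ : ℝ → ℝ} {a b : EReal} (hab : a ≤ b)
    (h : ∀ f : ℝ → ℝ, Integrable f a b → (∀ n, Integrable (fun x => f x * g n x) a b) ∧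
      Integrable (fun x => f x * g₀ x) a b ∧
      Tendsto (fun n => alexiewiczNorm (fun x => f x * g n x) a b) atTop
        (𝓝 (alexiewiczNorm (fun x => f x * g₀ x) a b))) :
    PointwiseBounded (fun n x => g n x - g₀ x) a b := by
  intro f F hF
  obtain ⟨h1, h2, h3⟩ := h f ((integrable_iff_exists_isPrim hab).2 ⟨F, hF⟩)
  -- Only boundedness of the norms is kept; their limit plays no further role.
  obtain ⟨B, hB⟩ := h3.bddAbove_range
  obtain ⟨G₀, hG₀⟩ := (integrable_iff_exists_isPrim hab).1 h2
  refine ⟨B + alexiewiczNorm (fun x => f x * g₀ x) a b, fun n => ?_⟩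
  obtain ⟨G, hG⟩ := (integrable_iff_exists_isPrim hab).1 (h1 n)
  refine ⟨fun x => G x - G₀ x, by simpa only [mul_sub] using hG.lift_sub hG₀,
    fun x y k1 k2 k3 k4 => ?_⟩
  have e1 := abs_le.1 ((hG.oscLe_alexiewiczNorm x y k1 k2 k3 k4).trans (hB ⟨n, rfl⟩))
  have e2 := abs_le.1 (hG₀.oscLe_alexiewiczNorm x y k1 k2 k3 k4)
  rw [abs_le]
  constructor <;> linarith [e1.1, e1.2, e2.1, e2.2]

theorem PointwiseBounded.tendsto_alexiewiczNorm {g : ℕ → ℝ → ℝ} {g₀ : ℝ → ℝ} {a b : EReal}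
    (hab : a ≤ b) (hb : PointwiseBounded (fun n x => g n x - g₀ x) a b)
    (hae : ∀ᵐ x ∂(volume.restrict (openInterval a b)),
      Tendsto (fun n => g n x) atTop (𝓝 (g₀ x))) {f : ℝ → ℝ} (hf : Integrable f a b) :
    Tendsto (fun n => alexiewiczNorm (fun x => f x * g n x - f x * g₀ x) a b) atTop (𝓝 0) := by
  obtain ⟨F, hF⟩ := (integrable_iff_exists_isPrim hab).1 hf
  have hm : MeasurableSet (openInterval a b) :=
    measurable_coe_real_ereal (measurableSet_Ioo (a := a) (b := b))
  rw [ae_restrict_iff' hm] at hae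
  have hann := hb.annihilates hab (by
    filter_upwards [hae] with x hx h1 h2
    simpa using (hx ⟨h1, h2⟩).sub_const (g₀ x)) hF
  obtain ⟨B, hB⟩ := hb f F hF
  choose H hH _ using hB
  have hH' : ∀ n, IsPrim (lift fun x => f x * g n x - f x * g₀ x) (H n) a b := fun n => by
    simpa only [mul_sub] using hH n
  rw [Metric.tendsto_nhds]
  intro ε hε
  filter_upwards [hann _ (half_pos hε)] with n hn
  rw [Real.dist_0_eq_abs, abs_of_nonneg ((hH' n).alexiewiczNorm_nonneg hab)]
  exact ((hH' n).alexiewiczNorm_le hab (hn _ (hH n))).trans_lt (half_lt_self hε)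

end HK

/-! ### The equivalence -/

theorem theorem5 (a b : EReal) (hab : a < b) (g : ℕ → ℝ → ℝ) (g₀ : ℝ → ℝ)
    (hg : TendstoInMeasure (volume.restrict (HK.openInterval a b)) g atTop g₀ ∨
      ∀ᵐ x ∂(volume.restrict (HK.openInterval a b)),
        Tendsto (fun n => g n x) atTop (𝓝 (g₀ x))) :
    (∀ f : ℝ → ℝ, HK.Integrable f a b →
      (∀ n, HK.Integrable (fun x => f x * g n x) a b) ∧
      HK.Integrable (fun x => f x * g₀ x) a b ∧
      Tendsto (fun n => HK.alexiewiczNorm (fun x => f x * g n x) a b) atTop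
        (𝓝 (HK.alexiewiczNorm (fun x => f x * g₀ x) a b))) ↔
    (∀ f : ℝ → ℝ, HK.Integrable f a b →
      (∀ n, HK.Integrable (fun x => f x * g n x) a b) ∧
      HK.Integrable (fun x => f x * g₀ x) a b ∧
      Tendsto (fun n => HK.alexiewiczNorm (fun x => f x * g n x - f x * g₀ x) a b) atTop
        (𝓝 0)) := by
  constructor
  · intro h f hf
    refine ⟨(h f hf).1, (h f hf).2.1, ?_⟩
    have hb := HK.pointwiseBounded_sub hab.le h
    rcases hg with hg | hg
    -- Every subsequence has a further one converging almost everywhere, and pointwise boundedness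
    -- passes to subsequences.
    · refine tendsto_of_subseq_tendsto fun ns hns => ?_
      obtain ⟨ms, -, hms⟩ := (hg.comp hns).exists_seq_tendsto_ae
      refine ⟨ms, HK.PointwiseBounded.tendsto_alexiewiczNorm (g := fun i => g (ns (ms i))) hab.le
        (fun f F hF => ?_) hms hf⟩
      obtain ⟨B, hB⟩ := hb f F hF
      exact ⟨B, fun n => hB _⟩
    · exact hb.tendsto_alexiewiczNorm hab.le hg hf
  · intro h f hf
    obtain ⟨h1, h2, h3⟩ := h f hf
    refine ⟨h1, h2, ?_⟩
    obtain ⟨G₀, hG₀⟩ := (HK.integrable_iff_exists_isPrim hab.le).1 h2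
    rw [tendsto_iff_dist_tendsto_zero]
    refine squeeze_zero (fun _ => dist_nonneg) (fun n => ?_) h3
    obtain ⟨G, hG⟩ := (HK.integrable_iff_exists_isPrim hab.le).1 (h1 n)
    exact HK.abs_alexiewiczNorm_sub_le hab.le hG hG₀
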